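/- Let $0<\gamma<1$, $1<\alpha<2$, $x_R>0$, $T>0$, and put $\sigma=\frac{\gamma}{1-\gamma}$ and $\kappa_\alpha=-\frac{1}{2\cos(\alpha\pi/2)}$. Let $u$ be a classical solution on $[0,x_R]\times[0,T]$ of $$\frac1{1-\gamma}\int_0^t \partial_s u(x,s)\,e^{-\sigma(t-s)}\,ds=\kappa_\alpha\big({}_0D_x^\alpha+{}_xD_{x_R}^\alpha\big)u(x,t)+f(x,t),\qquad 0<x<x_R,\ 0<t\le T,$$ with $u(x,0)=u_0(x)$ for $0<x<x_R$ and $u(0,t)=u(x_R,t)=0$ for $0\le t\le T$, where ${}_0D_x^\alpha w(x)=\frac1{\Gamma(2-\alpha)}\frac{d^2}{dx^2}\int_0^x(x-\xi)^{1-\alpha}w(\xi)\,d\xi$ and ${}_xD_{x_R}^\alpha w(x)=\frac1{\Gamma(2-\alpha)}\frac{d^2}{dx^2}\int_x^{x_R}(\xi-x)^{1-\alpha}w(\xi)\,d\xi$ are the Riemann-Liouville derivatives. (Classical means that $u$ is continuous on $[0,x_R]\times[0,T]$ and that the derivatives in the equation exist: for $0<x<x_R$ the function $u(x,\cdot)$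 is differentiable on $(0,T)$ with integrable derivative, and for $0<t\le T$ the two integrals in the Riemann-Liouville derivatives are $C^2$ functions of $x$ on $(0,x_R)$.) Define $g^\alpha_0=1$, $g^\alpha_1=-4+2^{3-\alpha}$, $g^\alpha_2=6-2^{5-\alpha}+3^{3-\alpha}$, and $g^\alpha_m=(m+1)^{3-\alpha}-4m^{3-\alpha}+6(m-1)^{3-\alpha}-4(m-2)^{3-\alpha}+(m-3)^{3-\alpha}$ for $m\ge3$; and set $g^\alpha_{i,i}=2g^\alpha_1$, $g^\alpha_{i,i\pm1}=g^\alpha_0+g^\alpha_2$, and $g^\alpha_{i,m}=g^\alpha_{|i-m|+1}$ for $|i-m|\ge2$. For integers $N_x\ge1$, $N\ge0$ and a real $\tau>0$ with $N\tau\le T$, let $\Delta x=x_R/N_x$, $x_i=i\Delta x$ $(0\le i\le N_x)$, $t_n=n\tau$ $(0\le n\le N)$, $f^n_i=f(x_i,t_n)$. The truncation error of $u$ at $(x_i,t_n)$, $1\le i\le N_x-1$, $1\le n\le N$, is $$r^n_i=\frac1{1-\gamma}\sum_{k=1}^n\frac{u(x_i,t_k)-u(x_i,t_{k-1})}{\sigma\tau}e^{-\sigma(n-k)\tau}(1-e^{-\sigma\tau})-\frac{\kappa_\alpha}{\Gamma(4-\alpha)(\Delta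 x)^\alpha}\sum_{m=0}^{N_x}g^\alpha_{i,m}u(x_m,t_n)-f^n_i .$$ The approximate solution $(u^n_i)_{0\le n\le N,\,0\le i\le N_x}$ is computed by the implicit difference scheme, for $1\le i\le N_x-1$, $1\le n\le N$, $$u^n_i-\kappa_{\Delta x,\tau}\sum_{m=0}^{N_x}g^\alpha_{i,m}u^n_m=\sum_{k=1}^{n-1}u^k_i e^{-\sigma(n-1-k)\tau}(1-e^{-\sigma\tau})+u^0_ie^{-\sigma(n-1)\tau}+\frac{(1-\gamma)\sigma\tau}{1-e^{-\sigma\tau}}f^n_i,$$ where $\kappa_{\Delta x,\tau}=\frac{(1-\gamma)\sigma\tau}{1-e^{-\sigma\tau}}\cdot\frac{\kappa_\alpha}{\Gamma(4-\alpha)(\Delta x)^\alpha}$, with $u^0_i=u_0(x_i)$ for $1\le i\le N_x-1$ and $u^n_0=u^n_{N_x}=0$ for $0\le n\le N$. Let $\varepsilon^n_i=u(x_i,t_n)-u^n_i$ and $\|\varepsilon^n\|_\infty=\max_{0\le i\le N_x}|\varepsilon^n_i|$. Then: 1. Suppose $u$ is sufficiently smooth in the following sense: $u(x,\cdot)\in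 C^2([0,T])$ for every $0<x<x_R$; for every $t\in[0,T]$ the extension by zero of $u(\cdot,t)$ from $[0,x_R]$ to $\mathbb R$ is in $C^4(\mathbb R)$; and the second time derivatives and the fourth space derivatives of these functions are bounded by one constant, uniformly in $x$ and $t$. Then there is a constant $C_u>0$, independent of $N_x$, $N$ and $\tau$ (hence of $\Delta x$), such that for all such $N_x,N,\tau$, $$|r^n_i|\le C_u\big(\tau^2+(\Delta x)^2\big)\qquad(1\le i\le N_x-1,\ 1\le n\le N).\tag{$*$}$$ 2. Whenever a constant $C_u>0$ satisfies $(*)$ on a given mesh (in particular, on every mesh for the $C_u$ of part 1), the approximate solution on that mesh satisfies, for all $0\le n\le N$, $$\|\varepsilon^n\|_\infty\le(1-\gamma)\big(\sigma T+e^{\sigma\tau}\big)\,C_u\,\big(\tau^2+(\Delta x)^2\big).$$ -/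

import Mathlib

open MeasureTheory Set

noncomputable section

namespace CaputoFabrizio

/-- The rate `σ = γ / (1 - γ)`. -/
def sigma (γ : ℝ) : ℝ := γ / (1 - γ)

/-- The Caputo-Fabrizio derivative of order `γ ∈ (0,1)` of a function of time. -/
def cfDeriv (γ : ℝ) (w : ℝ → ℝ) (t : ℝ) : ℝ :=
  1 / (1 - γ) * ∫ s in (0 : ℝ)..t, deriv w s * Real.exp (-sigma γ * (t - s))

/-- The integral whose second derivative is, up to `Γ(2-α)`, the left Riemann-Liouville
derivative based at `0`. -/
def leftPotential (α : ℝ) (w : ℝ → ℝ) (x : ℝ) : ℝ :=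
  ∫ ξ in (0 : ℝ)..x, (x - ξ) ^ (1 - α) * w ξ

/-- The integral whose second derivative is, up to `Γ(2-α)`, the right Riemann-Liouville
derivative based at `xR`. -/
def rightPotential (α xR : ℝ) (w : ℝ → ℝ) (x : ℝ) : ℝ :=
  ∫ ξ in x..xR, (ξ - x) ^ (1 - α) * w ξ

/-- The left Riemann-Liouville derivative of order `α ∈ (1,2)`. -/
def leftRL (α : ℝ) (w : ℝ → ℝ) (x : ℝ) : ℝ :=
  1 / Real.Gamma (2 - α) * iteratedDeriv 2 (leftPotential α w) x

/-- The right Riemann-Liouville derivative of order `α ∈ (1,2)`. -/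
def rightRL (α xR : ℝ) (w : ℝ → ℝ) (x : ℝ) : ℝ :=
  1 / Real.Gamma (2 - α) * iteratedDeriv 2 (rightPotential α xR w) x

/-- The constant `κ_α = -1 / (2 cos(απ/2))`. -/
def kappa (α : ℝ) : ℝ := -1 / (2 * Real.cos (α * Real.pi / 2))

/-- The Riesz derivative of order `α ∈ (1,2)` on `(0, xR)`. -/
def rieszDeriv (α xR : ℝ) (w : ℝ → ℝ) (x : ℝ) : ℝ :=
  kappa α * (leftRL α w x + rightRL α xR w x)

/-- `u` is a classical solution on `[0,xR] × [0,T]` of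
`D_t^γ u = ∂^α u / ∂|x|^α + f`, with `u(x,0) = u₀(x)` and homogeneous Dirichlet boundary
conditions. The first four fields say that the derivatives in the equation exist. -/
structure IsClassicalSolution (γ α xR T : ℝ) (f : ℝ → ℝ → ℝ) (u₀ : ℝ → ℝ)
    (u : ℝ → ℝ → ℝ) : Prop where
  continuousOn : ContinuousOn (fun p : ℝ × ℝ => u p.1 p.2) (Icc 0 xR ×ˢ Icc 0 T)
  differentiableOn : ∀ x ∈ Ioo 0 xR, DifferentiableOn ℝ (u x) (Ioo 0 T)
  integrable : ∀ x ∈ Ioo 0 xR, IntervalIntegrable (deriv (u x)) volume 0 T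
  contDiffAt : ∀ x ∈ Ioo 0 xR, ∀ t ∈ Ioc 0 T,
    ContDiffAt ℝ 2 (leftPotential α (fun y => u y t)) x ∧
      ContDiffAt ℝ 2 (rightPotential α xR (fun y => u y t)) x
  equation : ∀ x ∈ Ioo 0 xR, ∀ t ∈ Ioc 0 T,
    cfDeriv γ (u x) t = rieszDeriv α xR (fun y => u y t) x + f x t
  initial : ∀ x ∈ Ioo 0 xR, u x 0 = u₀ x
  boundary : ∀ t ∈ Icc 0 T, u 0 t = 0 ∧ u xR t = 0

/-- Smoothness of the exact solution: `u` is `C²` in time on `[0,T]`, the extension of `u` by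
zero outside `[0,xR]` is `C⁴` in space on the whole line, and the second time derivative and the
fourth space derivative are bounded. -/
def IsSufficientlySmooth (xR T : ℝ) (u : ℝ → ℝ → ℝ) : Prop :=
  ∃ M : ℝ,
    (∀ x ∈ Ioo 0 xR, ContDiffOn ℝ 2 (u x) (Icc 0 T) ∧
      ∀ t ∈ Icc 0 T, |iteratedDerivWithin 2 (u x) (Icc 0 T) t| ≤ M) ∧
    (∀ t ∈ Icc 0 T, ContDiff ℝ 4 ((Icc 0 xR).indicator fun x => u x t) ∧
      ∀ x, |iteratedDeriv 4 ((Icc 0 xR).indicator fun x => u x t) x| ≤ M)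

/-- The coefficients `g^α_m`. -/
def gCoeff (α : ℝ) (m : ℕ) : ℝ :=
  if m = 0 then 1
  else if m = 1 then -4 + 2 ^ (3 - α)
  else if m = 2 then 6 - 2 ^ (5 - α) + 3 ^ (3 - α)
  else ((m : ℝ) + 1) ^ (3 - α) - 4 * (m : ℝ) ^ (3 - α) + 6 * ((m : ℝ) - 1) ^ (3 - α)
    - 4 * ((m : ℝ) - 2) ^ (3 - α) + ((m : ℝ) - 3) ^ (3 - α)

/-- The coefficients `g^α_{i,m}`, used for `i ≥ 1`. -/
def gEntry (α : ℝ) (i m : ℕ) : ℝ :=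
  if m + 1 < i then gCoeff α (i - m + 1)
  else if m + 1 = i then gCoeff α 0 + gCoeff α 2
  else if m = i then 2 * gCoeff α 1
  else if m = i + 1 then gCoeff α 0 + gCoeff α 2
  else gCoeff α (m - i + 1)

/-- The space step `Δx = xR / Nx`. -/
def spaceStep (xR : ℝ) (Nx : ℕ) : ℝ := xR / Nx

/-- The coefficient `κ_α / (Γ(4-α) (Δx)^α)` of the discrete Riesz derivative. -/
def rieszCoeff (α xR : ℝ) (Nx : ℕ) : ℝ :=
  kappa α / (Real.Gamma (4 - α) * spaceStep xR Nx ^ α)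

/-- The local truncation error `r^n_i` at `(x_i, t_n) = (i Δx, n τ)`: the residual obtained by
putting the exact solution into the L1 discretization. -/
def truncationError (γ α xR : ℝ) (f u : ℝ → ℝ → ℝ) (Nx : ℕ) (τ : ℝ) (n i : ℕ) : ℝ :=
  1 / (1 - γ) * ∑ k ∈ Finset.Icc 1 n,
      (u (i * spaceStep xR Nx) (k * τ) - u (i * spaceStep xR Nx) (((k : ℝ) - 1) * τ))
        / (sigma γ * τ)
        * Real.exp (-sigma γ * ((n : ℝ) - k) * τ) * (1 - Real.exp (-sigma γ * τ))
    - rieszCoeff α xR Nx *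
        ∑ m ∈ Finset.range (Nx + 1), gEntry α i m * u (m * spaceStep xR Nx) (n * τ)
    - f (i * spaceStep xR Nx) (n * τ)

/-- The bound `|r^n_i| ≤ C (τ² + (Δx)²)` at all interior nodes of one mesh. -/
def TruncationBound (γ α xR : ℝ) (f u : ℝ → ℝ → ℝ) (Nx N : ℕ) (τ C : ℝ) : Prop :=
  ∀ n ∈ Finset.Icc 1 N, ∀ i ∈ Finset.Ioo 0 Nx,
    |truncationError γ α xR f u Nx τ n i| ≤ C * (τ ^ 2 + spaceStep xR Nx ^ 2)

/-- The coefficient `(1-γ) σ τ / (1 - e^{-στ})`. -/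
def timeCoeff (γ τ : ℝ) : ℝ :=
  (1 - γ) * sigma γ * τ / (1 - Real.exp (-sigma γ * τ))

/-- The array `v n i = u^n_i`, `0 ≤ n ≤ N`, `0 ≤ i ≤ Nx`, solves the implicit difference scheme
with initial values `u₀` and homogeneous Dirichlet boundary values. -/
structure IsSchemeSolution (γ α xR : ℝ) (f : ℝ → ℝ → ℝ) (u₀ : ℝ → ℝ) (Nx N : ℕ) (τ : ℝ)
    (v : ℕ → ℕ → ℝ) : Prop where
  step : ∀ n ∈ Finset.Icc 1 N, ∀ i ∈ Finset.Ioo 0 Nx,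
    v n i - timeCoeff γ τ * rieszCoeff α xR Nx *
        ∑ m ∈ Finset.range (Nx + 1), gEntry α i m * v n m
      = ∑ k ∈ Finset.Ico 1 n,
          v k i * Real.exp (-sigma γ * ((n : ℝ) - 1 - k) * τ) * (1 - Real.exp (-sigma γ * τ))
        + v 0 i * Real.exp (-sigma γ * ((n : ℝ) - 1) * τ)
        + timeCoeff γ τ * f (i * spaceStep xR Nx) (n * τ)
  initial : ∀ i ∈ Finset.Ioo 0 Nx, v 0 i = u₀ (i * spaceStep xR Nx)
  boundary : ∀ n ≤ N, v n 0 = 0 ∧ v n Nx = 0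

/-- The error vector `ε^n = (u(x_i,t_n) - u^n_i)`, `0 ≤ i ≤ Nx`; its norm is the maximum norm. -/
def errorVec (xR : ℝ) (u : ℝ → ℝ → ℝ) (Nx : ℕ) (τ : ℝ) (v : ℕ → ℕ → ℝ) (n : ℕ) :
    Fin (Nx + 1) → ℝ :=
  fun i => u ((i : ℕ) * spaceStep xR Nx) (n * τ) - v n i

end CaputoFabrizio

end

noncomputable section

namespace CaputoFabrizio

/-! ### The coefficients of the discrete Riesz derivative -/

/-! Put `β = 3 - α`, which lies in `(1,2)`. The `gCoeff` are third backward differences of `powDiff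
β`, extended by zero to negative indices, that is, fourth differences of `k ^ β`. This gives both
the signs needed for stability and the meaning of the space stencil.

Stability. Off-diagonal entries of the discrete Riesz operator are nonnegative
(`gEntry_nonneg_of_ne`) and row sums nonpositive (`sum_gEntry_nonpos`), so an implicit step does not
enlarge the maximum norm (`abs_le_of_implicit_step`). By Abel summation the error solves the scheme
with source `timeCoeff * r`, where `r` is the truncation error (`error_step`). With `q = e^{-στ}`,
the memory sum grows by at most `(1-q) b` per step if the source is at most `b`
(`memory_sum_bound`). Since `(1-q) * timeCoeff = (1-γ)στ`, the growth adds up to the factor `σT`.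

Consistency in time. The difference quotient is the mean of `w'` over a step, so a constant may be
subtracted from the exponential weight. The local error is then a product of two `O(τ)` factors
integrated over length `τ`, and there are at most `T/τ` steps.

Consistency in space. The left half of the stencil is exactly the integral of the kernel `y^{1-α}`
against the piecewise linear interpolant of central second differences. The zero extension `W` is
`C⁴`, so the two derivatives of the Riemann-Liouville potential may be moved onto `W`
(`iteratedDeriv_two_fracConv`) without boundary terms. What remains is an `O(h²)` pointwise error
against an integrable kernel. The right half is the mirror image (`rightRL_eq_leftRL`). -/

/-- The forward difference of `x ↦ x ^ β` at a natural number. -/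
def powDiff (β : ℝ) (k : ℕ) : ℝ := ((k : ℝ) + 1) ^ β - (k : ℝ) ^ β

lemma hasDerivAt_add_rpow (c p x : ℝ) (h : 0 < x + c) :
    HasDerivAt (fun y : ℝ => (y + c) ^ p) (p * (x + c) ^ (p - 1)) x := by
  simpa using ((hasDerivAt_id x).add_const c).rpow_const (p := p) (Or.inl h.ne')

/-- The second derivative is `β(β-1)((x+1)^{β-2} - x^{β-2})`, nonpositive because `β - 2 < 0`. The
`x + 0` gives both terms the shape of `hasDerivAt_add_rpow`. -/
lemma concaveOn_rpow_sub_rpow {β : ℝ} (hβ : β ∈ Ioo (1 : ℝ) 2) :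
    ConcaveOn ℝ (Ici 0) (fun x : ℝ => (x + 1) ^ β - (x + 0) ^ β) := by
  obtain ⟨h1, h2⟩ := hβ
  refine concaveOn_of_hasDerivWithinAt2_nonpos (convex_Ici 0)
    (f' := fun x => β * (x + 1) ^ (β - 1) - β * (x + 0) ^ (β - 1))
    (f'' := fun x => β * ((β - 1) * (x + 1) ^ (β - 1 - 1))
      - β * ((β - 1) * (x + 0) ^ (β - 1 - 1))) ?_ ?_ ?_ ?_
  · refine ContinuousOn.sub ?_ ?_ <;>
    exact ContinuousOn.rpow_const (by fun_prop) (fun x _ => Or.inr (by linarith))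
  all_goals
    intro x hx
    rw [interior_Ici] at hx
    have hx0 : (0 : ℝ) < x := hx
  · exact ((hasDerivAt_add_rpow 1 β x (by linarith)).sub
      (hasDerivAt_add_rpow 0 β x (by linarith))).hasDerivWithinAt
  · exact (((hasDerivAt_add_rpow 1 (β - 1) x (by linarith)).const_mul β).sub
      ((hasDerivAt_add_rpow 0 (β - 1) x (by linarith)).const_mul β)).hasDerivWithinAt
  · have : (x + 1) ^ (β - 1 - 1) ≤ (x + 0) ^ (β - 1 - 1) :=
      Real.rpow_le_rpow_of_nonpos (by linarith) (by linarith) (by linarith)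
    have := mul_le_mul_of_nonneg_left this (mul_pos (by linarith : 0 < β) (sub_pos.2 h1)).le
    linarith

/-- Raising `x(x+2) ≤ (x+1)²` to a nonpositive power reverses it, and the arithmetic mean of the two
outer powers dominates their geometric mean. -/
lemma two_mul_rpow_le_of_nonpos {x r : ℝ} (hx : 0 < x) (hr : r ≤ 0) :
    2 * (x + 1) ^ r ≤ (x + 2) ^ r + x ^ r := by
  have h1 : ((x + 1) * (x + 1)) ^ r ≤ ((x + 2) * x) ^ r :=
    Real.rpow_le_rpow_of_nonpos (by positivity) (by nlinarith) hr
  rw [Real.mul_rpow (by positivity) (by positivity),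
    Real.mul_rpow (by positivity) (by positivity)] at h1
  have h2 : 0 ≤ (x + 2) ^ r := by positivity
  have h3 : 0 ≤ x ^ r := by positivity
  apply abs_le_of_sq_le_sq' _ (by positivity) |>.2
  nlinarith [sq_nonneg ((x + 2) ^ r - x ^ r)]

lemma convexOn_rpow_second_difference {β : ℝ} (hβ : β ∈ Ioo (1 : ℝ) 2) :
    ConvexOn ℝ (Ici 0) (fun x : ℝ => (x + 2) ^ β - 2 * (x + 1) ^ β + (x + 0) ^ β) := by
  obtain ⟨h1, h2⟩ := hβ
  refine convexOn_of_hasDerivWithinAt2_nonneg (convex_Ici 0)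
    (f' := fun x => β * (x + 2) ^ (β - 1) - 2 * (β * (x + 1) ^ (β - 1))
      + β * (x + 0) ^ (β - 1))
    (f'' := fun x => β * ((β - 1) * (x + 2) ^ (β - 1 - 1))
      - 2 * (β * ((β - 1) * (x + 1) ^ (β - 1 - 1)))
      + β * ((β - 1) * (x + 0) ^ (β - 1 - 1))) ?_ ?_ ?_ ?_
  · refine ContinuousOn.add (ContinuousOn.sub ?_ (ContinuousOn.mul continuousOn_const ?_)) ?_ <;>
    exact ContinuousOn.rpow_const (by fun_prop) (fun x _ => Or.inr (by linarith))
  all_goals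
    intro x hx
    rw [interior_Ici] at hx
    have hx0 : (0 : ℝ) < x := hx
  · exact (((hasDerivAt_add_rpow 2 β x (by linarith)).sub
      ((hasDerivAt_add_rpow 1 β x (by linarith)).const_mul 2)).add
      (hasDerivAt_add_rpow 0 β x (by linarith))).hasDerivWithinAt
  · exact ((((hasDerivAt_add_rpow 2 (β - 1) x (by linarith)).const_mul β).sub
      (((hasDerivAt_add_rpow 1 (β - 1) x (by linarith)).const_mul β).const_mul 2)).add
      ((hasDerivAt_add_rpow 0 (β - 1) x (by linarith)).const_mul β)).hasDerivWithinAt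
  · have := two_mul_rpow_le_of_nonpos hx0 (by linarith : β - 1 - 1 ≤ 0)
    have := mul_le_mul_of_nonneg_left this (mul_pos (by linarith : 0 < β) (sub_pos.2 h1)).le
    rw [add_zero]
    linarith

lemma powDiff_second_difference_nonpos {β : ℝ} (hβ : β ∈ Ioo (1 : ℝ) 2) (k : ℕ) :
    powDiff β (k + 2) - 2 * powDiff β (k + 1) + powDiff β k ≤ 0 := by
  have h := (concaveOn_rpow_sub_rpow hβ).2
    (show (k : ℝ) ∈ Ici 0 from mem_Ici.2 k.cast_nonneg) (show (k : ℝ) + 2 ∈ Ici 0 from by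
      rw [mem_Ici]; positivity)
    (by norm_num : (0 : ℝ) ≤ 1 / 2) (by norm_num : (0 : ℝ) ≤ 1 / 2) (by norm_num)
  simp only [smul_eq_mul, add_zero] at h
  rw [show (1 / 2 * (k : ℝ) + 1 / 2 * (k + 2)) = k + 1 by ring] at h
  simp only [powDiff]
  push_cast
  rw [add_assoc (k : ℝ) 1 1] at h ⊢
  norm_num at h ⊢
  linarith

/-- This is a fourth difference of `k ^ β`, hence the second difference of a second difference;
midpoint convexity at `k`, `k+1`, `k+2` gives the sign. -/
lemma powDiff_third_difference_nonneg {β : ℝ} (hβ : β ∈ Ioo (1 : ℝ) 2) (k : ℕ) :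
    0 ≤ powDiff β (k + 3) - 3 * powDiff β (k + 2) + 3 * powDiff β (k + 1) - powDiff β k := by
  have h := (convexOn_rpow_second_difference hβ).2
    (show (k : ℝ) ∈ Ici 0 from mem_Ici.2 k.cast_nonneg) (show (k : ℝ) + 2 ∈ Ici 0 from by
      rw [mem_Ici]; positivity)
    (by norm_num : (0 : ℝ) ≤ 1 / 2) (by norm_num : (0 : ℝ) ≤ 1 / 2) (by norm_num)
  simp only [smul_eq_mul, add_zero] at h
  rw [show (1 / 2 * (k : ℝ) + 1 / 2 * (k + 2)) = k + 1 by ring] at h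
  simp only [powDiff]
  push_cast
  simp only [add_assoc] at h ⊢
  norm_num at h ⊢
  linarith

lemma gCoeff_zero (α : ℝ) (hα : α ∈ Ioo (1 : ℝ) 2) : gCoeff α 0 = powDiff (3 - α) 0 := by
  simp [gCoeff, powDiff, Real.zero_rpow (by linarith [hα.2] : 3 - α ≠ 0)]

lemma gCoeff_one (α : ℝ) (hα : α ∈ Ioo (1 : ℝ) 2) :
    gCoeff α 1 = powDiff (3 - α) 1 - 3 * powDiff (3 - α) 0 := by
  simp [gCoeff, powDiff, Real.zero_rpow (by linarith [hα.2] : 3 - α ≠ 0)]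
  norm_num
  ring

lemma gCoeff_two (α : ℝ) (hα : α ∈ Ioo (1 : ℝ) 2) :
    gCoeff α 2 = powDiff (3 - α) 2 - 3 * powDiff (3 - α) 1 + 3 * powDiff (3 - α) 0 := by
  have : (2 : ℝ) ^ (5 - α) = 4 * 2 ^ (3 - α) := by
    rw [show 5 - α = (3 - α) + 2 by ring, Real.rpow_add (by norm_num)]
    norm_num
    ring
  simp [gCoeff, powDiff, Real.zero_rpow (by linarith [hα.2] : 3 - α ≠ 0), this]
  norm_num
  ring

lemma gCoeff_add_three (α : ℝ) (k : ℕ) :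
    gCoeff α (k + 3) = powDiff (3 - α) (k + 3) - 3 * powDiff (3 - α) (k + 2)
      + 3 * powDiff (3 - α) (k + 1) - powDiff (3 - α) k := by
  have e1 : ((k : ℝ) + 3 - 1) = k + 2 := by ring
  have e2 : ((k : ℝ) + 3 - 2) = k + 1 := by ring
  have e3 : ((k : ℝ) + 3 - 3) = k := by ring
  unfold gCoeff powDiff
  rw [if_neg (by omega), if_neg (by omega), if_neg (by omega)]
  push_cast
  rw [e1, e2, e3]
  simp only [add_assoc]
  norm_num
  ring

lemma three_sub_mem {α : ℝ} (hα : α ∈ Ioo (1 : ℝ) 2) : 3 - α ∈ Ioo (1 : ℝ) 2 :=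
  ⟨by linarith [hα.2], by linarith [hα.1]⟩

lemma gCoeff_nonneg_of_three_le {α : ℝ} (hα : α ∈ Ioo (1 : ℝ) 2) {m : ℕ} (hm : 3 ≤ m) :
    0 ≤ gCoeff α m := by
  obtain ⟨k, rfl⟩ := Nat.exists_eq_add_of_le' hm
  rw [gCoeff_add_three]
  exact powDiff_third_difference_nonneg (three_sub_mem hα) k

/-- Partial sums of third differences telescope to a second difference, whose sign comes from
concavity. -/
lemma sum_gCoeff {α : ℝ} (hα : α ∈ Ioo (1 : ℝ) 2) (n : ℕ) :
    ∑ j ∈ Finset.range (n + 3), gCoeff α j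
      = powDiff (3 - α) (n + 2) - 2 * powDiff (3 - α) (n + 1) + powDiff (3 - α) n := by
  induction n with
  | zero =>
    simp only [Finset.sum_range_succ, Finset.sum_range_zero, gCoeff_zero α hα, gCoeff_one α hα,
      gCoeff_two α hα]
    ring
  | succ n ih =>
    rw [show n + 1 + 3 = n + 3 + 1 by ring, Finset.sum_range_succ, ih, gCoeff_add_three]
    ring_nf

lemma sum_gCoeff_nonpos {α : ℝ} (hα : α ∈ Ioo (1 : ℝ) 2) {n : ℕ} (hn : 3 ≤ n) :
    ∑ j ∈ Finset.range n, gCoeff α j ≤ 0 := by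
  obtain ⟨k, rfl⟩ := Nat.exists_eq_add_of_le' hn
  rw [sum_gCoeff hα]
  exact powDiff_second_difference_nonpos (three_sub_mem hα) k

lemma gCoeff_zero_add_two_nonneg {α : ℝ} (hα : α ∈ Ioo (1 : ℝ) 2) :
    0 ≤ gCoeff α 0 + gCoeff α 2 := by
  set t : ℝ := α - 1 with ht
  have ht0 : 0 < t := by linarith [hα.1]
  have h2 : (2 : ℝ) ^ (5 - α) = 4 * (4 / 2 ^ t) := by
    rw [show 5 - α = 4 - t by rw [ht]; ring, Real.rpow_sub (by norm_num)]
    norm_num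
    ring
  have h3 : (3 : ℝ) ^ (3 - α) = 9 / 3 ^ t := by
    rw [show 3 - α = 2 - t by rw [ht]; ring, Real.rpow_sub (by norm_num)]
    norm_num
  simp only [gCoeff]
  norm_num
  rw [h2, h3]
  -- The sum equals `7 - 16/2^t + 9/3^t`. Multiplied by `2^t/16` it compares a weighted mean of
  -- `(2/3)^t` and `2^t` with `1`; the geometric mean is `(2^16/3^9)^{t/16} ≥ 1`.
  have key := Real.geom_mean_le_arith_mean2_weighted (w₁ := 9 / 16) (w₂ := 7 / 16)
    (p₁ := ((2 : ℝ) / 3) ^ t) (p₂ := (2 : ℝ) ^ t) (by norm_num) (by norm_num) (by positivity)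
    (by positivity) (by norm_num)
  have h1 : (1 : ℝ) ≤ (((2 : ℝ) / 3) ^ t) ^ (9 / 16 : ℝ) * ((2 : ℝ) ^ t) ^ (7 / 16 : ℝ) := by
    have : (((2 : ℝ) / 3) ^ t) ^ (9 / 16 : ℝ) * ((2 : ℝ) ^ t) ^ (7 / 16 : ℝ)
        = (((2 : ℝ) / 3) ^ (9 : ℝ) * 2 ^ (7 : ℝ)) ^ (t / 16) := by
      rw [Real.mul_rpow (by positivity) (by positivity), ← Real.rpow_mul (by norm_num),
        ← Real.rpow_mul (by norm_num), ← Real.rpow_mul (by norm_num),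
        ← Real.rpow_mul (by norm_num)]
      congr 2 <;> ring
    rw [this]
    exact Real.one_le_rpow (by norm_num) (by positivity)
  rw [Real.div_rpow (by norm_num) (by norm_num)] at h1 key
  have hkey := h1.trans key
  have p2 : (0 : ℝ) < 2 ^ t := by positivity
  have p3 : (0 : ℝ) < 3 ^ t := by positivity
  have : 1 + (6 - 4 * (4 / (2 : ℝ) ^ t) + 9 / (3 : ℝ) ^ t)
      = 16 / (2 : ℝ) ^ t * ((9 / 16 * ((2 : ℝ) ^ t / (3 : ℝ) ^ t) + 7 / 16 * (2 : ℝ) ^ t) - 1) := by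
    field_simp
    ring
  rw [this]
  exact mul_nonneg (by positivity) (by linarith)

lemma gEntry_nonneg_of_ne {α : ℝ} (hα : α ∈ Ioo (1 : ℝ) 2) {i m : ℕ} (h : m ≠ i) :
    0 ≤ gEntry α i m := by
  have h02 := gCoeff_zero_add_two_nonneg hα
  unfold gEntry
  split_ifs with h1 h2 h3
  · exact gCoeff_nonneg_of_three_le hα (by omega)
  · exact h02
  · exact h02
  · exact gCoeff_nonneg_of_three_le hα (by omega)

/-- The left stencil and its mirror image overlap exactly at `m = i-1, i, i+1`, which explains the
special entries there. The conditions keep the truncated subtractions from contributing spurious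
terms. -/
lemma gEntry_eq_add (α : ℝ) {i : ℕ} (hi : 1 ≤ i) (m : ℕ) :
    gEntry α i m = (if m < i + 2 then gCoeff α (i + 1 - m) else 0)
      + (if i - 1 ≤ m then gCoeff α (m - (i - 1)) else 0) := by
  unfold gEntry
  by_cases h1 : m + 1 < i
  · rw [if_pos h1, if_pos (by omega), if_neg (by omega), show i + 1 - m = i - m + 1 by omega,
      add_zero]
  by_cases h2 : m + 1 = i
  · rw [if_neg h1, if_pos h2, if_pos (by omega), if_pos (by omega), show i + 1 - m = 2 by omega,
      show m - (i - 1) = 0 by omega, add_comm]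
  by_cases h3 : m = i
  · rw [if_neg h1, if_neg h2, if_pos h3, if_pos (by omega), if_pos (by omega),
      show i + 1 - m = 1 by omega, show m - (i - 1) = 1 by omega, two_mul]
  by_cases h4 : m = i + 1
  · rw [if_neg h1, if_neg h2, if_neg h3, if_pos h4, if_pos (by omega), if_pos (by omega),
      show i + 1 - m = 0 by omega, show m - (i - 1) = 2 by omega]
  · rw [if_neg h1, if_neg h2, if_neg h3, if_neg h4, if_neg (by omega), if_pos (by omega),
      show m - (i - 1) = m - i + 1 by omega, zero_add]

/-- The discrete Riesz derivative is a left sum plus its mirror image. -/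
lemma sum_gEntry_mul (α : ℝ) {i n : ℕ} (hi : i ∈ Finset.Ioo 0 n) (w : ℕ → ℝ) :
    ∑ m ∈ Finset.range (n + 1), gEntry α i m * w m
      = ∑ j ∈ Finset.range (i + 2), gCoeff α j * w (i + 1 - j)
        + ∑ j ∈ Finset.range (n - i + 2), gCoeff α j * w (i - 1 + j) := by
  obtain ⟨h0, hn⟩ := Finset.mem_Ioo.1 hi
  simp only [gEntry_eq_add α h0, add_mul, Finset.sum_add_distrib, ite_mul, zero_mul]
  congr 1
  · rw [← Finset.sum_filter, ← Finset.sum_range_reflect (fun j => gCoeff α j * w (i + 1 - j))]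
    have : (Finset.range (n + 1)).filter (fun m => m < i + 2) = Finset.range (i + 2) := by
      ext m; simp; omega
    rw [this]
    refine Finset.sum_congr rfl fun m hm => ?_
    rw [Finset.mem_range] at hm
    rw [show i + 2 - 1 - m = i + 1 - m by omega, show i + 1 - (i + 1 - m) = m by omega]
  · rw [← Finset.sum_filter]
    have : (Finset.range (n + 1)).filter (fun m => i - 1 ≤ m) = Finset.Ico (i - 1) (n + 1) := by
      ext m; simp; omega
    rw [this, Finset.sum_Ico_eq_sum_range]
    refine Finset.sum_congr (by congr 1; omega) fun m _ => ?_
    rw [Nat.add_sub_cancel_left]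

lemma sum_gEntry_nonpos {α : ℝ} (hα : α ∈ Ioo (1 : ℝ) 2) {i n : ℕ} (hi : i ∈ Finset.Ioo 0 n) :
    ∑ m ∈ Finset.range (n + 1), gEntry α i m ≤ 0 := by
  have h := sum_gEntry_mul α hi (fun _ => 1)
  simp only [mul_one] at h
  obtain ⟨h0, hn⟩ := Finset.mem_Ioo.1 hi
  rw [h]
  -- Since `0 < i < n`, both sums have at least three terms; a single term would be `g_0 = 1 > 0`.
  exact add_nonpos (sum_gCoeff_nonpos hα (by omega)) (sum_gCoeff_nonpos hα (by omega))

/-! ### The discrete maximum principle and stability -/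

lemma sigma_pos {γ : ℝ} (hγ : γ ∈ Ioo (0 : ℝ) 1) : 0 < sigma γ :=
  div_pos hγ.1 (sub_pos.2 hγ.2)

lemma kappa_pos {α : ℝ} (hα : α ∈ Ioo (1 : ℝ) 2) : 0 < kappa α := by
  have : Real.cos (α * Real.pi / 2) < 0 := by
    apply Real.cos_neg_of_pi_div_two_lt_of_lt <;> nlinarith [Real.pi_pos, hα.1, hα.2]
  exact div_pos_of_neg_of_neg (by norm_num) (by linarith)

lemma spaceStep_pos {xR : ℝ} (hxR : 0 < xR) {Nx : ℕ} (h : 1 ≤ Nx) : 0 < spaceStep xR Nx :=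
  div_pos hxR (by exact_mod_cast h)

lemma rieszCoeff_pos {α xR : ℝ} (hα : α ∈ Ioo (1 : ℝ) 2) (hxR : 0 < xR) {Nx : ℕ} (h : 1 ≤ Nx) :
    0 < rieszCoeff α xR Nx :=
  div_pos (kappa_pos hα) (mul_pos (Real.Gamma_pos_of_pos (by linarith [hα.2]))
    (Real.rpow_pos_of_pos (spaceStep_pos hxR h) _))

lemma exp_neg_sigma_mul_lt_one {γ τ : ℝ} (hγ : γ ∈ Ioo (0 : ℝ) 1) (hτ : 0 < τ) :
    Real.exp (-sigma γ * τ) < 1 := by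
  rw [Real.exp_lt_one_iff]
  nlinarith [mul_pos (sigma_pos hγ) hτ]

lemma timeCoeff_pos {γ τ : ℝ} (hγ : γ ∈ Ioo (0 : ℝ) 1) (hτ : 0 < τ) : 0 < timeCoeff γ τ :=
  div_pos (mul_pos (mul_pos (sub_pos.2 hγ.2) (sigma_pos hγ)) hτ)
    (sub_pos.2 (exp_neg_sigma_mul_lt_one hγ hτ))

/-- The discrete maximum principle for `1 - a g` with `a ≥ 0`. -/
lemma abs_le_of_implicit_step {α a K : ℝ} (hα : α ∈ Ioo (1 : ℝ) 2) (ha : 0 ≤ a) (hK : 0 ≤ K)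
    {n : ℕ} {e : ℕ → ℝ} (h0 : e 0 = 0) (hn : e n = 0)
    (h : ∀ i ∈ Finset.Ioo 0 n,
      |e i - a * ∑ m ∈ Finset.range (n + 1), gEntry α i m * e m| ≤ K) :
    ∀ i ∈ Finset.range (n + 1), |e i| ≤ K := by
  obtain ⟨i, hi, hmax⟩ := (Finset.range (n + 1)).exists_max_image (fun i => |e i|) (by simp)
  suffices hs : |e i| ≤ K from fun j hj => (hmax j hj).trans hs
  by_cases hi0 : i = 0
  · rw [hi0, h0, abs_zero]; exact hK
  by_cases hin : i = n
  · rw [hin, hn, abs_zero]; exact hK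
  have hi' : i ∈ Finset.Ioo 0 n := by
    rw [Finset.mem_range] at hi
    rw [Finset.mem_Ioo]
    omega
  -- At an index of maximal modulus the off-diagonal part is at most `S |e i|`, and `g_ii + S ≤ 0`.
  -- Hence the left side of the step has modulus at least `(1 - a (g_ii + S)) |e i| ≥ |e i|`.
  have hrow := sum_gEntry_nonpos hα hi'
  rw [← Finset.add_sum_erase _ _ hi] at hrow
  have hstep := h i hi'
  rw [← Finset.add_sum_erase _ _ hi] at hstep
  set S := ∑ m ∈ (Finset.range (n + 1)).erase i, gEntry α i m with hS
  set S' := ∑ m ∈ (Finset.range (n + 1)).erase i, gEntry α i m * e m with hS'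
  have hSnn : 0 ≤ S := Finset.sum_nonneg fun m hm =>
    gEntry_nonneg_of_ne hα (Finset.ne_of_mem_erase hm)
  have hle : |S'| ≤ S * |e i| := by
    rw [hS, Finset.sum_mul]
    refine (Finset.abs_sum_le_sum_abs _ _).trans (Finset.sum_le_sum fun m hm => ?_)
    have hg := gEntry_nonneg_of_ne hα (Finset.ne_of_mem_erase hm)
    rw [abs_mul, abs_of_nonneg hg]
    exact mul_le_mul_of_nonneg_left (hmax m (Finset.mem_of_mem_erase hm)) hg
  have hg : gEntry α i i ≤ 0 := by linarith
  have hnn := abs_nonneg (e i)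
  have e1 : e i - a * (gEntry α i i * e i + S') = (1 - a * gEntry α i i) * e i - a * S' := by
    ring
  have hpos : 0 ≤ 1 - a * gEntry α i i := by nlinarith
  have h2 := abs_sub_abs_le_abs_sub ((1 - a * gEntry α i i) * e i) (a * S')
  rw [← e1, abs_mul, abs_mul, abs_of_nonneg hpos, abs_of_nonneg ha] at h2
  have h3 : a * |S'| ≤ a * (S * |e i|) := mul_le_mul_of_nonneg_left hle ha
  have h4 : 0 ≤ a * ((-(gEntry α i i + S)) * |e i|) :=
    mul_nonneg ha (mul_nonneg (by linarith) hnn)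
  nlinarith

/-- The convolution sum `∑_{k=1}^{n} E_k q^{n-k} (1-q)`, as a recursion. -/
lemma memory_sum_bound {E : ℕ → ℝ} {b q : ℝ} (hq : q ≤ 1) {N : ℕ}
    (hE : ∀ n < N, E (n + 1) ≤ ∑ k ∈ Finset.Ico 1 (n + 1), E k * q ^ (n - k) * (1 - q) + b) :
    ∀ n < N, E (n + 1) ≤ b + n * ((1 - q) * b) := by
  -- If `S_n` is the memory sum, then `S_{n+1} = q S_n + (1-q) E_{n+1} ≤ q S_n + (1-q)(S_n + b) =
  -- S_n + (1-q) b`.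
  have hS : ∀ n < N, ∑ k ∈ Finset.Ico 1 (n + 1), E k * q ^ (n - k) * (1 - q)
      ≤ n * ((1 - q) * b) := by
    intro n
    induction n with
    | zero => simp
    | succ n ih =>
      intro hn
      have ih' := ih (by omega)
      have hE' := hE n (by omega)
      rw [Finset.sum_Ico_succ_top (by omega)]
      have : ∑ k ∈ Finset.Ico 1 (n + 1), E k * q ^ (n + 1 - k) * (1 - q)
          = q * ∑ k ∈ Finset.Ico 1 (n + 1), E k * q ^ (n - k) * (1 - q) := by
        rw [Finset.mul_sum]
        refine Finset.sum_congr rfl fun k hk => ?_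
        rw [Finset.mem_Ico] at hk
        rw [show n + 1 - k = (n - k) + 1 by omega, pow_succ]
        ring
      rw [this]
      set S := ∑ k ∈ Finset.Ico 1 (n + 1), E k * q ^ (n - k) * (1 - q)
      push_cast
      simp only [Nat.sub_self, pow_zero, mul_one]
      have hq1 : 0 ≤ 1 - q := by linarith
      nlinarith [mul_le_mul_of_nonneg_right hE' hq1]
  intro n hn
  linarith [hE n hn, hS n hn]

/-! ### The error equation of the scheme. -/

lemma exp_neg_sigma_mul_nat (γ τ : ℝ) (m : ℕ) :
    Real.exp (-sigma γ * (m : ℝ) * τ) = Real.exp (-sigma γ * τ) ^ m := by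
  rw [← Real.exp_nat_mul]
  ring_nf

/-- Summation by parts in the time discretization. -/
lemma time_sum_by_parts (w : ℕ → ℝ) (q : ℝ) (n : ℕ) :
    ∑ k ∈ Finset.Icc 1 (n + 1), (w k - w (k - 1)) * q ^ (n + 1 - k)
      = w (n + 1) - ∑ k ∈ Finset.Ico 1 (n + 1), w k * q ^ (n - k) * (1 - q) - w 0 * q ^ n := by
  induction n with
  | zero => simp
  | succ n ih =>
    rw [← Finset.insert_Icc_right_eq_Icc_add_one (by omega), Finset.sum_insert (by simp),
      Finset.sum_Ico_succ_top (by omega)]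
    have h1 : ∑ k ∈ Finset.Icc 1 (n + 1), (w k - w (k - 1)) * q ^ (n + 1 + 1 - k)
        = q * ∑ k ∈ Finset.Icc 1 (n + 1), (w k - w (k - 1)) * q ^ (n + 1 - k) := by
      rw [Finset.mul_sum]
      refine Finset.sum_congr rfl fun k hk => ?_
      rw [Finset.mem_Icc] at hk
      rw [show n + 1 + 1 - k = (n + 1 - k) + 1 by omega, pow_succ]
      ring
    have h2 : ∑ k ∈ Finset.Ico 1 (n + 1), w k * q ^ (n + 1 - k) * (1 - q)
        = q * ∑ k ∈ Finset.Ico 1 (n + 1), w k * q ^ (n - k) * (1 - q) := by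
      rw [Finset.mul_sum]
      refine Finset.sum_congr rfl fun k hk => ?_
      rw [Finset.mem_Ico] at hk
      rw [show n + 1 - k = (n - k) + 1 by omega, pow_succ]
      ring
    rw [h1, h2, ih]
    simp only [Nat.sub_self, pow_zero, Nat.add_sub_cancel]
    ring

lemma exp_weight (γ τ : ℝ) {n k : ℕ} (h : k ≤ n) :
    Real.exp (-sigma γ * ((n : ℝ) - k) * τ) = Real.exp (-sigma γ * τ) ^ (n - k) := by
  rw [← exp_neg_sigma_mul_nat, Nat.cast_sub h]

lemma timeCoeff_mul_weight {γ τ : ℝ} (hγ : γ ∈ Ioo (0 : ℝ) 1) (hτ : 0 < τ) (d e : ℝ) :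
    timeCoeff γ τ * (1 / (1 - γ) *
      (d / (sigma γ * τ) * e * (1 - Real.exp (-sigma γ * τ)))) = d * e := by
  have h1 := sub_pos.2 (exp_neg_sigma_mul_lt_one hγ hτ)
  have h2 := sigma_pos hγ
  have h3 := sub_pos.2 hγ.2
  unfold timeCoeff
  set E := Real.exp (-sigma γ * τ)
  field_simp

/-- Multiplying by `timeCoeff` normalizes the weight of the newest value to one, and summation by
parts brings the residual into the form of the scheme. -/
lemma timeCoeff_mul_truncationError {γ α xR τ : ℝ} (hγ : γ ∈ Ioo (0 : ℝ) 1) (hτ : 0 < τ)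
    (f u : ℝ → ℝ → ℝ) (Nx n i : ℕ) :
    timeCoeff γ τ * truncationError γ α xR f u Nx τ (n + 1) i
      = u (i * spaceStep xR Nx) ((n + 1 : ℕ) * τ)
        - timeCoeff γ τ * rieszCoeff α xR Nx * ∑ m ∈ Finset.range (Nx + 1),
            gEntry α i m * u (m * spaceStep xR Nx) ((n + 1 : ℕ) * τ)
        - ∑ k ∈ Finset.Ico 1 (n + 1), u (i * spaceStep xR Nx) (k * τ)
            * Real.exp (-sigma γ * τ) ^ (n - k) * (1 - Real.exp (-sigma γ * τ))
        - u (i * spaceStep xR Nx) ((0 : ℕ) * τ) * Real.exp (-sigma γ * τ) ^ n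
        - timeCoeff γ τ * f (i * spaceStep xR Nx) ((n + 1 : ℕ) * τ) := by
  have h := time_sum_by_parts (fun k => u (i * spaceStep xR Nx) (k * τ))
    (Real.exp (-sigma γ * τ)) n
  have h' : timeCoeff γ τ * (1 / (1 - γ) * ∑ k ∈ Finset.Icc 1 (n + 1),
      (u (i * spaceStep xR Nx) (k * τ) - u (i * spaceStep xR Nx) (((k : ℝ) - 1) * τ))
        / (sigma γ * τ)
        * Real.exp (-sigma γ * (((n + 1 : ℕ) : ℝ) - k) * τ) * (1 - Real.exp (-sigma γ * τ)))
      = ∑ k ∈ Finset.Icc 1 (n + 1), (u (i * spaceStep xR Nx) (k * τ)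
          - u (i * spaceStep xR Nx) ((k - 1 : ℕ) * τ)) * Real.exp (-sigma γ * τ) ^ (n + 1 - k) := by
    rw [Finset.mul_sum, Finset.mul_sum]
    refine Finset.sum_congr rfl fun k hk => ?_
    rw [Finset.mem_Icc] at hk
    rw [timeCoeff_mul_weight hγ hτ, exp_weight γ τ hk.2, Nat.cast_sub hk.1, Nat.cast_one]
  unfold truncationError
  rw [mul_sub, mul_sub, h', h]
  ring

lemma error_step {γ α xR τ : ℝ} (hγ : γ ∈ Ioo (0 : ℝ) 1) (hτ : 0 < τ)
    {f u : ℝ → ℝ → ℝ} {u₀ : ℝ → ℝ} {Nx N : ℕ} {v : ℕ → ℕ → ℝ}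
    (hv : IsSchemeSolution γ α xR f u₀ Nx N τ v) {n : ℕ} (hn : n < N) {i : ℕ}
    (hi : i ∈ Finset.Ioo 0 Nx) (e : ℕ → ℕ → ℝ)
    (he : ∀ n i, e n i = u (i * spaceStep xR Nx) (n * τ) - v n i) (he0 : e 0 i = 0) :
    e (n + 1) i - timeCoeff γ τ * rieszCoeff α xR Nx *
        ∑ m ∈ Finset.range (Nx + 1), gEntry α i m * e (n + 1) m
      = ∑ k ∈ Finset.Ico 1 (n + 1), e k i * Real.exp (-sigma γ * τ) ^ (n - k)
          * (1 - Real.exp (-sigma γ * τ))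
        + timeCoeff γ τ * truncationError γ α xR f u Nx τ (n + 1) i := by
  have h1 := hv.step (n + 1) (Finset.mem_Icc.2 ⟨by omega, by omega⟩) i hi
  have h2 : ∑ k ∈ Finset.Ico 1 (n + 1), v k i
        * Real.exp (-sigma γ * (((n + 1 : ℕ) : ℝ) - 1 - k) * τ) * (1 - Real.exp (-sigma γ * τ))
      = ∑ k ∈ Finset.Ico 1 (n + 1), v k i * Real.exp (-sigma γ * τ) ^ (n - k)
          * (1 - Real.exp (-sigma γ * τ)) := by
    refine Finset.sum_congr rfl fun k hk => ?_
    rw [Finset.mem_Ico] at hk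
    rw [← exp_weight γ τ (by omega : k ≤ n), Nat.cast_add, Nat.cast_one, add_sub_cancel_right]
  have h3 : Real.exp (-sigma γ * (((n + 1 : ℕ) : ℝ) - 1) * τ) = Real.exp (-sigma γ * τ) ^ n := by
    rw [← exp_neg_sigma_mul_nat, Nat.cast_add, Nat.cast_one, add_sub_cancel_right]
  rw [h2, h3] at h1
  rw [timeCoeff_mul_truncationError hγ hτ]
  have h4 : u (i * spaceStep xR Nx) ((0 : ℕ) * τ) = v 0 i := by
    have := he 0 i
    rw [he0] at this
    linarith
  rw [h4]
  simp only [he, sub_mul, mul_sub, Finset.sum_sub_distrib] at h1 ⊢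
  linear_combination -h1

lemma timeCoeff_stability_le {γ τ T : ℝ} (hγ : γ ∈ Ioo (0 : ℝ) 1) (hτ : 0 < τ) {n : ℕ}
    (hn : n * τ ≤ T) :
    timeCoeff γ τ + n * ((1 - Real.exp (-sigma γ * τ)) * timeCoeff γ τ)
      ≤ (1 - γ) * (sigma γ * T + Real.exp (sigma γ * τ)) := by
  have h1 := sub_pos.2 (exp_neg_sigma_mul_lt_one hγ hτ)
  have h2 := sigma_pos hγ
  have h3 := sub_pos.2 hγ.2
  have h4 : (1 - Real.exp (-sigma γ * τ)) * timeCoeff γ τ = (1 - γ) * sigma γ * τ := by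
    unfold timeCoeff
    exact mul_div_cancel₀ _ h1.ne'
  -- With `x = στ` this is `x ≤ e^x (1 - e^{-x}) = e^x - 1`.
  have h5 : timeCoeff γ τ ≤ (1 - γ) * Real.exp (sigma γ * τ) := by
    unfold timeCoeff
    rw [div_le_iff₀ h1, mul_assoc, mul_assoc]
    refine mul_le_mul_of_nonneg_left ?_ h3.le
    rw [mul_sub, ← Real.exp_add]
    have := Real.add_one_le_exp (sigma γ * τ)
    norm_num
    linarith
  rw [h4]
  have h6 : (1 - γ) * sigma γ * (n * τ) ≤ (1 - γ) * sigma γ * T :=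
    mul_le_mul_of_nonneg_left hn (by positivity)
  linarith

/-- Stability of the scheme: a bound on the truncation error gives a bound on the error. -/
theorem norm_errorVec_le {γ α xR T : ℝ} (hγ : γ ∈ Ioo (0 : ℝ) 1) (hα : α ∈ Ioo (1 : ℝ) 2)
    (hxR : 0 < xR) (hT : 0 < T) {f u : ℝ → ℝ → ℝ} {u₀ : ℝ → ℝ}
    (hinit : ∀ x ∈ Ioo 0 xR, u x 0 = u₀ x)
    (hbdry : ∀ t ∈ Icc 0 T, u 0 t = 0 ∧ u xR t = 0) {Nx N : ℕ} {τ C : ℝ} (hNx : 1 ≤ Nx)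
    (hτ : 0 < τ) (hN : N * τ ≤ T) (hC : 0 < C) (htr : TruncationBound γ α xR f u Nx N τ C)
    {v : ℕ → ℕ → ℝ} (hv : IsSchemeSolution γ α xR f u₀ Nx N τ v) {n : ℕ} (hn : n ≤ N) :
    ‖errorVec xR u Nx τ v n‖ ≤ (1 - γ) * (sigma γ * T + Real.exp (sigma γ * τ)) *
      C * (τ ^ 2 + spaceStep xR Nx ^ 2) := by
  set e : ℕ → ℕ → ℝ := fun n i => u (i * spaceStep xR Nx) (n * τ) - v n i with he
  have hNx0 : (0 : ℝ) < Nx := by exact_mod_cast hNx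
  have hstepN : (Nx : ℝ) * spaceStep xR Nx = xR := by
    unfold spaceStep
    field_simp
  have hb : ∀ n ≤ N, e n 0 = 0 ∧ e n Nx = 0 := by
    intro n hn
    have hmem : (n : ℝ) * τ ∈ Icc 0 T := by
      refine ⟨by positivity, le_trans ?_ hN⟩
      have : (n : ℝ) ≤ N := by exact_mod_cast hn
      exact mul_le_mul_of_nonneg_right this hτ.le
    simp only [he, hstepN, Nat.cast_zero, zero_mul, hv.boundary n hn, hbdry _ hmem, sub_zero,
      and_self]
  have he0 : ∀ i ∈ Finset.Ioo 0 Nx, e 0 i = 0 := by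
    intro i hi
    obtain ⟨hi0, hi1⟩ := Finset.mem_Ioo.1 hi
    have h0 : (0 : ℝ) < i := by exact_mod_cast hi0
    have h1 : (i : ℝ) < Nx := by exact_mod_cast hi1
    have hs := spaceStep_pos hxR hNx
    have := hinit (i * spaceStep xR Nx) ⟨by positivity,
      (mul_lt_mul_of_pos_right h1 hs).trans_eq hstepN⟩
    simp only [he, Nat.cast_zero, zero_mul, this, hv.initial i hi, sub_self]
  set R := C * (τ ^ 2 + spaceStep xR Nx ^ 2) with hR
  have hRnn : 0 ≤ R := by positivity
  have htc := timeCoeff_pos hγ hτ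
  have hexp := exp_neg_sigma_mul_lt_one hγ hτ
  set q := Real.exp (-sigma γ * τ) with hq
  have hq0 : 0 < q := Real.exp_pos _
  have hErr : ∀ n, ∀ i ∈ Finset.range (Nx + 1), |e n i| ≤ ‖errorVec xR u Nx τ v n‖ := by
    intro n i hi
    exact norm_le_pi_norm (errorVec xR u Nx τ v n) ⟨i, Finset.mem_range.1 hi⟩
  have hnorm : ∀ n K, 0 ≤ K → (∀ i ∈ Finset.range (Nx + 1), |e n i| ≤ K) →
      ‖errorVec xR u Nx τ v n‖ ≤ K := by
    intro n K hK h
    rw [pi_norm_le_iff_of_nonneg hK]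
    exact fun i => h i (Finset.mem_range.2 i.2)
  have hfin : 0 ≤ (1 - γ) * (sigma γ * T + Real.exp (sigma γ * τ)) := by
    have := sigma_pos hγ
    have := sub_pos.2 hγ.2
    positivity
  rw [mul_assoc _ C, ← hR]
  cases n with
  | zero =>
    refine (hnorm 0 0 le_rfl fun i hi => ?_).trans (mul_nonneg hfin hRnn)
    rw [Finset.mem_range] at hi
    by_cases h0 : i = 0
    · rw [h0, (hb 0 (by omega)).1, abs_zero]
    by_cases h1 : i = Nx
    · rw [h1, (hb 0 (by omega)).2, abs_zero]
    rw [he0 i (Finset.mem_Ioo.2 (by omega)), abs_zero]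
  | succ n =>
    have key := memory_sum_bound (E := fun n => ‖errorVec xR u Nx τ v n‖) (b := timeCoeff γ τ * R)
      (q := q) (N := N) hexp.le ?_ n (by omega)
    · refine key.trans ?_
      have hnT : (n : ℝ) * τ ≤ T := by
        refine le_trans ?_ hN
        have : (n : ℝ) ≤ N := by exact_mod_cast (by omega : n ≤ N)
        exact mul_le_mul_of_nonneg_right this hτ.le
      have := mul_le_mul_of_nonneg_right (timeCoeff_stability_le hγ hτ hnT) hRnn
      linarith
    · intro n hn
      have hK : 0 ≤ ∑ k ∈ Finset.Ico 1 (n + 1), ‖errorVec xR u Nx τ v k‖ * q ^ (n - k) * (1 - q) :=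
        Finset.sum_nonneg fun k _ =>
          mul_nonneg (mul_nonneg (norm_nonneg _) (by positivity)) (by linarith)
      have hK' := add_nonneg hK (mul_nonneg htc.le hRnn)
      refine hnorm (n + 1) _ hK' ?_
      refine abs_le_of_implicit_step hα (mul_pos htc (rieszCoeff_pos hα hxR hNx)).le hK'
        (hb (n + 1) hn).1 (hb (n + 1) hn).2 fun i hi => ?_
      rw [error_step hγ hτ hv hn hi e (fun _ _ => rfl) (he0 i hi)]
      refine (abs_add_le _ _).trans (add_le_add ?_ ?_)
      · refine (Finset.abs_sum_le_sum_abs _ _).trans (Finset.sum_le_sum fun k _ => ?_)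
        rw [abs_mul, abs_mul, abs_of_nonneg (by linarith : 0 ≤ 1 - q),
          abs_of_nonneg (by positivity : 0 ≤ q ^ (n - k))]
        have := hErr k i (Finset.mem_range.2 (by have := Finset.mem_Ioo.1 hi; omega))
        have hq1 : 0 ≤ 1 - q := by linarith
        gcongr
      · rw [abs_mul, abs_of_pos htc]
        exact mul_le_mul_of_nonneg_left
          (htr (n + 1) (Finset.mem_Icc.2 ⟨by omega, by omega⟩) i hi) htc.le

/-! ### Consistency of the time discretization -/

lemma integral_exp_weight {σ : ℝ} (hσ : σ ≠ 0) (a b t : ℝ) :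
    ∫ s in a..b, Real.exp (-σ * (t - s))
      = (Real.exp (-σ * (t - b)) - Real.exp (-σ * (t - a))) / σ := by
  have h : ∀ s ∈ uIcc a b, HasDerivAt (fun s => Real.exp (-σ * (t - s)) / σ)
      (Real.exp (-σ * (t - s))) s := by
    intro s _
    have := ((((hasDerivAt_id s).const_sub t).const_mul (-σ)).exp).div_const σ
    refine this.congr_deriv ?_
    simp [hσ]
  rw [intervalIntegral.integral_eq_sub_of_hasDerivAt h
    (Continuous.intervalIntegrable (by fun_prop) _ _)]
  ring

lemma abs_exp_weight_sub_le {σ a s t : ℝ} (hσ : 0 < σ) (ha : a ≤ s) (hs : s ≤ t) :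
    |Real.exp (-σ * (t - s)) - Real.exp (-σ * (t - a))| ≤ σ * (s - a) := by
  have h0 : -σ * (t - s) ≤ 0 := by nlinarith
  have h1 : Real.exp (-σ * (t - s)) ≤ 1 := Real.exp_le_one_iff.2 h0
  have h2 : Real.exp (-σ * (t - a)) = Real.exp (-σ * (t - s)) * Real.exp (-(σ * (s - a))) := by
    rw [← Real.exp_add]; ring_nf
  have h3 := Real.add_one_le_exp (-(σ * (s - a)))
  have h4 : 0 ≤ σ * (s - a) := mul_nonneg hσ.le (by linarith)
  have h5 : Real.exp (-(σ * (s - a))) ≤ 1 := Real.exp_le_one_iff.2 (by linarith)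
  have h6 := Real.exp_pos (-σ * (t - s))
  rw [h2, abs_of_nonneg (by nlinarith)]
  nlinarith

/-- The `L1` error on one time step, for a function with `M`-Lipschitz derivative. -/
lemma abs_integral_deriv_sub_slope_le {w w' : ℝ → ℝ} {σ M a b t : ℝ} (hσ : 0 < σ) (hab : a < b)
    (hbt : b ≤ t) (hw : ∀ s ∈ Icc a b, HasDerivWithinAt w (w' s) (Icc a b) s)
    (hw' : ContinuousOn w' (Icc a b))
    (hL : ∀ s ∈ Icc a b, ∀ r ∈ Icc a b, |w' s - w' r| ≤ M * |s - r|) :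
    |(∫ s in a..b, w' s * Real.exp (-σ * (t - s)))
        - (w b - w a) / (b - a) * ∫ s in a..b, Real.exp (-σ * (t - s))|
      ≤ M * σ * (b - a) ^ 3 := by
  have hba : 0 < b - a := sub_pos.2 hab
  have hu : uIcc a b = Icc a b := uIcc_of_le hab.le
  have hM : 0 ≤ M := by
    have h := (abs_nonneg _).trans (hL a (left_mem_Icc.2 hab.le) b (right_mem_Icc.2 hab.le))
    exact nonneg_of_mul_nonneg_left h (abs_pos.2 (by linarith))
  set m := (w b - w a) / (b - a) with hm
  -- The slope is a value of `w'`, so `w' - m` is at most `M (b - a)` on the step.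
  obtain ⟨c, hc, hcm⟩ : ∃ c ∈ Ioo a b, w' c = m := by
    refine exists_hasDerivAt_eq_slope w w' hab (fun s hs => (hw s hs).continuousWithinAt) ?_
    exact fun s hs => (hw s (Ioo_subset_Icc_self hs)).hasDerivAt (Icc_mem_nhds hs.1 hs.2)
  have hi1 : IntervalIntegrable w' volume a b :=
    ContinuousOn.intervalIntegrable (by rwa [hu])
  have hftc : ∫ s in a..b, w' s = w b - w a := by
    refine intervalIntegral.integral_eq_sub_of_hasDerivAt_of_le hab.le
      (fun s hs => (hw s hs).continuousWithinAt) (fun s hs => ?_) hi1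
    exact (hw s (Ioo_subset_Icc_self hs)).hasDerivAt (Icc_mem_nhds hs.1 hs.2)
  set E : ℝ → ℝ := fun s => Real.exp (-σ * (t - s)) with hE
  have hEc : Continuous E := by fun_prop
  have hi2 : IntervalIntegrable (fun s => w' s * E s) volume a b :=
    ContinuousOn.intervalIntegrable (by rw [hu]; exact hw'.mul hEc.continuousOn)
  have hi3 : IntervalIntegrable E volume a b := hEc.intervalIntegrable _ _
  -- As `w' - m` has mean zero, subtracting the constant `E a` costs nothing and gains one order in
  -- `b - a`.
  have heq : (∫ s in a..b, w' s * E s) - m * ∫ s in a..b, E s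
      = ∫ s in a..b, (w' s - m) * (E s - E a) := by
    have : ∀ s, (w' s - m) * (E s - E a) = (w' s * E s - m * E s) - (E a * w' s - E a * m) :=
      fun s => by ring
    simp_rw [this]
    rw [intervalIntegral.integral_sub (hi2.sub (hi3.const_mul m))
      ((hi1.const_mul _).sub intervalIntegrable_const),
      intervalIntegral.integral_sub hi2 (hi3.const_mul m),
      intervalIntegral.integral_sub (hi1.const_mul _) intervalIntegrable_const,
      intervalIntegral.integral_const_mul, intervalIntegral.integral_const_mul,
      intervalIntegral.integral_const, hftc, hm, smul_eq_mul]
    field_simp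
    ring
  rw [heq]
  have hbd : ∀ s ∈ uIoc a b, ‖(w' s - m) * (E s - E a)‖ ≤ M * (b - a) * (σ * (b - a)) := by
    intro s hs
    rw [uIoc_of_le hab.le] at hs
    rw [norm_mul, ← hcm]
    have h1 := hL s (Ioc_subset_Icc_self hs) c (Ioo_subset_Icc_self hc)
    have h2 := abs_exp_weight_sub_le hσ hs.1.le (hs.2.trans hbt)
    have h3 : |s - c| ≤ b - a := abs_le.2 ⟨by linarith [hs.1, hc.2], by linarith [hs.2, hc.1]⟩
    refine mul_le_mul (h1.trans ?_) (h2.trans ?_) (norm_nonneg _) (by positivity)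
    · gcongr
    · gcongr
      exact hs.2
  have := intervalIntegral.norm_integral_le_of_norm_le_const hbd
  rw [Real.norm_eq_abs, abs_of_pos hba] at this
  exact this.trans_eq (by ring)

/-- The `L1` discretization of the Caputo-Fabrizio derivative is second order accurate. -/
theorem abs_time_discretization_sub_cfDeriv_le {γ T M τ : ℝ} (hγ : γ ∈ Ioo (0 : ℝ) 1) (hT : 0 < T)
    (hτ : 0 < τ) {w : ℝ → ℝ} (hw : ContDiffOn ℝ 2 w (Icc 0 T))
    (hM : ∀ t ∈ Icc 0 T, |iteratedDerivWithin 2 w (Icc 0 T) t| ≤ M) {n : ℕ} (hn : n * τ ≤ T) :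
    |1 / (1 - γ) * ∑ k ∈ Finset.Icc 1 n, (w (k * τ) - w (((k : ℝ) - 1) * τ)) / (sigma γ * τ)
        * Real.exp (-sigma γ * ((n : ℝ) - k) * τ) * (1 - Real.exp (-sigma γ * τ))
      - cfDeriv γ w (n * τ)| ≤ 1 / (1 - γ) * (M * sigma γ * T) * τ ^ 2 := by
  have hσ := sigma_pos hγ
  have hγ' := sub_pos.2 hγ.2
  have hud := uniqueDiffOn_Icc hT
  set w' := derivWithin w (Icc 0 T) with hw'def
  have hM0 : 0 ≤ M := (abs_nonneg _).trans (hM 0 (left_mem_Icc.2 hT.le))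
  have hder : ∀ s ∈ Icc 0 T, HasDerivWithinAt w (w' s) (Icc 0 T) s := fun s hs =>
    ((hw.differentiableOn (by norm_num)) s hs).hasDerivWithinAt
  have hC1 : ContDiffOn ℝ 1 w' (Icc 0 T) := hw.derivWithin hud (by norm_num)
  have hcont : ContinuousOn w' (Icc 0 T) := hC1.continuousOn
  have hL : ∀ s ∈ Icc 0 T, ∀ r ∈ Icc 0 T, |w' s - w' r| ≤ M * |s - r| := by
    intro s hs r hr
    refine (convex_Icc 0 T).norm_image_sub_le_of_norm_hasDerivWithin_le (f := w')
      (f' := derivWithin w' (Icc 0 T)) (fun x hx =>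
        ((hC1.differentiableOn (by norm_num)) x hx).hasDerivWithinAt) (fun x hx => ?_) hr hs
    have := hM x hx
    rwa [iteratedDerivWithin_succ, iteratedDerivWithin_one] at this
  have hmem : ∀ k ≤ n, (k : ℝ) * τ ∈ Icc 0 T := fun k hk => by
    refine ⟨by positivity, le_trans ?_ hn⟩
    have : (k : ℝ) ≤ n := by exact_mod_cast hk
    gcongr
  have hsub : ∀ k < n, Icc ((k : ℝ) * τ) ((k + 1 : ℕ) * τ) ⊆ Icc 0 T := fun k hk =>
    Icc_subset_Icc (hmem k hk.le).1 (hmem (k + 1) hk).2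
  have hle : ∀ k : ℕ, (k : ℝ) * τ < (k + 1 : ℕ) * τ := fun k => by
    push_cast
    nlinarith
  have hcf : cfDeriv γ w (n * τ) = 1 / (1 - γ) * ∑ k ∈ Finset.range n,
      ∫ s in ((k : ℝ) * τ)..((k + 1 : ℕ) * τ), w' s * Real.exp (-sigma γ * (n * τ - s)) := by
    unfold cfDeriv
    congr 1
    rw [intervalIntegral.sum_integral_adjacent_intervals (a := fun k : ℕ => (k : ℝ) * τ)]
    · simp only [Nat.cast_zero, zero_mul]
      have h0n : (0 : ℝ) ≤ n * τ := by positivity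
      -- Passing to the open interval discards the endpoints, where `deriv` and `derivWithin` may
      -- differ.
      rw [intervalIntegral.integral_of_le h0n, intervalIntegral.integral_of_le h0n,
        integral_Ioc_eq_integral_Ioo, integral_Ioc_eq_integral_Ioo]
      refine setIntegral_congr_fun measurableSet_Ioo fun s hs => ?_
      have hs' : Icc 0 T ∈ nhds s := Icc_mem_nhds hs.1 (hs.2.trans_le hn)
      simp only [hw'def, derivWithin_of_mem_nhds hs']
    · intro k hk
      refine ContinuousOn.intervalIntegrable ?_
      rw [uIcc_of_le (hle k).le]
      exact (hcont.mono (hsub k hk)).mul (by fun_prop)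
  -- The L1 weights are exact integrals of the exponential over each step.
  have hsum : ∑ k ∈ Finset.Icc 1 n, (w (k * τ) - w (((k : ℝ) - 1) * τ)) / (sigma γ * τ)
        * Real.exp (-sigma γ * ((n : ℝ) - k) * τ) * (1 - Real.exp (-sigma γ * τ))
      = ∑ k ∈ Finset.range n, (w ((k + 1 : ℕ) * τ) - w (k * τ)) / ((k + 1 : ℕ) * τ - k * τ) *
          ∫ s in ((k : ℝ) * τ)..((k + 1 : ℕ) * τ), Real.exp (-sigma γ * (n * τ - s)) := by
    rw [← Finset.Ico_add_one_right_eq_Icc, Finset.sum_Ico_eq_sum_range]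
    refine Finset.sum_congr (by simp) fun k _ => ?_
    rw [integral_exp_weight hσ.ne', add_comm 1 k]
    have e1 : Real.exp (-sigma γ * (n * τ - k * τ))
        = Real.exp (-sigma γ * ((n : ℝ) - (k + 1 : ℕ)) * τ) * Real.exp (-sigma γ * τ) := by
      rw [← Real.exp_add]
      push_cast
      ring_nf
    have e2 : -sigma γ * (n * τ - (k + 1 : ℕ) * τ) = -sigma γ * ((n : ℝ) - (k + 1 : ℕ)) * τ := by
      ring
    rw [e1, e2]
    have e3 : ((k + 1 : ℕ) : ℝ) * τ - k * τ = τ := by push_cast; ring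
    have e4 : ((k + 1 : ℕ) : ℝ) - 1 = k := by push_cast; ring
    rw [e3, e4]
    field_simp
  rw [hsum, hcf, ← mul_sub, ← Finset.sum_sub_distrib, abs_mul, abs_of_pos (by positivity), mul_assoc]
  refine mul_le_mul_of_nonneg_left ?_ (by positivity)
  refine (Finset.abs_sum_le_sum_abs _ _).trans ?_
  have hterm : ∀ k ∈ Finset.range n,
      |(w ((k + 1 : ℕ) * τ) - w (k * τ)) / ((k + 1 : ℕ) * τ - k * τ) *
          (∫ s in ((k : ℝ) * τ)..((k + 1 : ℕ) * τ), Real.exp (-sigma γ * (n * τ - s)))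
        - ∫ s in ((k : ℝ) * τ)..((k + 1 : ℕ) * τ), w' s * Real.exp (-sigma γ * (n * τ - s))|
      ≤ M * sigma γ * τ ^ 3 := by
    intro k hk
    rw [Finset.mem_range] at hk
    rw [abs_sub_comm]
    have hkn : ((k + 1 : ℕ) : ℝ) * τ ≤ n * τ := by
      have : ((k + 1 : ℕ) : ℝ) ≤ n := by exact_mod_cast hk
      gcongr
    refine (abs_integral_deriv_sub_slope_le hσ (hle k) hkn
      (fun s hs => (hder s (hsub k hk hs)).mono (hsub k hk)) (hcont.mono (hsub k hk))
      (fun s hs r hr => hL s (hsub k hk hs) r (hsub k hk hr))).trans_eq ?_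
    push_cast
    ring
  refine (Finset.sum_le_sum hterm).trans ?_
  rw [Finset.sum_const, Finset.card_range, nsmul_eq_mul]
  have := mul_le_mul_of_nonneg_left hn (by positivity : 0 ≤ M * sigma γ * τ ^ 2)
  nlinarith

/-! ### Local approximation estimates -/

/-- The central second difference of a `C⁴` function. -/
lemma abs_second_difference_sub_le {W : ℝ → ℝ} {M : ℝ} (hW : ContDiff ℝ 4 W)
    (hM : ∀ x, |iteratedDeriv 4 W x| ≤ M) {h : ℝ} (hh : 0 ≤ h) (x : ℝ) :
    |W (x + h) - 2 * W x + W (x - h) - h ^ 2 * iteratedDeriv 2 W x| ≤ 2 * M * h ^ 4 := by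
  have hM0 : 0 ≤ M := (abs_nonneg _).trans (hM 0)
  have hd : ∀ k : ℕ, k < 4 → ∀ y, HasDerivAt (iteratedDeriv k W) (iteratedDeriv (k + 1) W y) y := by
    intro k hk y
    rw [iteratedDeriv_succ]
    exact ((hW.differentiable_iteratedDeriv k (by exact_mod_cast hk)) y).hasDerivAt
  have hp : ∀ k : ℕ, k < 4 → ∀ s, HasDerivAt (fun s => iteratedDeriv k W (x + s))
      (iteratedDeriv (k + 1) W (x + s)) s := fun k hk s => (hd k hk (x + s)).comp_const_add x s
  have hm : ∀ k : ℕ, k < 4 → ∀ s, HasDerivAt (fun s => iteratedDeriv k W (x - s))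
      (-iteratedDeriv (k + 1) W (x - s)) s := fun k hk s => (hd k hk (x - s)).comp_const_sub x s
  -- The remainder, as a function of the step `s`, vanishes at `0` with its first three derivatives.
  -- Its fourth derivative is bounded by `2M`, and each use of the mean value inequality gains one
  -- power of `s`; the factorials are not kept.
  have step : ∀ (g g' : ℝ → ℝ) (K : ℝ) (k : ℕ), 0 ≤ K → g 0 = 0 → (∀ s, HasDerivAt g (g' s) s) →
      (∀ s, 0 ≤ s → |g' s| ≤ K * s ^ k) → ∀ s, 0 ≤ s → |g s| ≤ K * s ^ (k + 1) := by
    intro g g' K k hK hg0 hg hg' s hs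
    have := (convex_Icc 0 s).norm_image_sub_le_of_norm_hasDerivWithin_le (f := g) (f' := g')
      (C := K * s ^ k) (fun y _ => (hg y).hasDerivWithinAt) (fun y hy => (hg' y hy.1).trans
        (mul_le_mul_of_nonneg_left (pow_le_pow_left₀ hy.1 hy.2 k) hK))
      (left_mem_Icc.2 hs) (right_mem_Icc.2 hs)
    rw [hg0, sub_zero, sub_zero, Real.norm_eq_abs, Real.norm_eq_abs, abs_of_nonneg hs] at this
    exact this.trans_eq (by ring)
  have h4 : ∀ s, 0 ≤ s → |iteratedDeriv 4 W (x + s) + iteratedDeriv 4 W (x - s)|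
      ≤ 2 * M * s ^ 0 := fun s _ => by
    refine (abs_add_le _ _).trans ?_
    have := hM (x + s)
    have := hM (x - s)
    linarith
  have h3 := step (fun s => iteratedDeriv 3 W (x + s) - iteratedDeriv 3 W (x - s)) _ (2 * M) 0
    (by positivity) (by simp) (fun s =>
      ((hp 3 (by norm_num) s).sub (hm 3 (by norm_num) s)).congr_deriv (sub_neg_eq_add _ _)) h4
  have h2 := step (fun s => iteratedDeriv 2 W (x + s) + iteratedDeriv 2 W (x - s)
      - 2 * iteratedDeriv 2 W x) _ (2 * M) 1
    (by positivity) (by simp; ring) (fun s =>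
      (((hp 2 (by norm_num) s).add (hm 2 (by norm_num) s)).sub_const _).congr_deriv
        (sub_eq_add_neg _ _).symm) h3
  have h1 := step (fun s => iteratedDeriv 1 W (x + s) - iteratedDeriv 1 W (x - s)
      - s * (2 * iteratedDeriv 2 W x)) _ (2 * M) 2
    (by positivity) (by simp) (fun s =>
      (((hp 1 (by norm_num) s).sub (hm 1 (by norm_num) s)).sub
        ((hasDerivAt_id s).mul_const (2 * iteratedDeriv 2 W x))).congr_deriv
        (by rw [sub_neg_eq_add, one_mul])) h2
  have h0 := step (fun s => W (x + s) + W (x - s) - 2 * W x - s ^ 2 * iteratedDeriv 2 W x) _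
    (2 * M) 3 (by positivity) (by simp; ring) (fun s => by
      have := (((hp 0 (by norm_num) s).add (hm 0 (by norm_num) s)).sub_const (2 * W x)).sub
        ((hasDerivAt_pow 2 s).mul_const (iteratedDeriv 2 W x))
      simp only [iteratedDeriv_zero, zero_add] at this
      refine this.congr_deriv ?_
      norm_num
      ring) h1 h hh
  rw [show W (x + h) - 2 * W x + W (x - h) = W (x + h) + W (x - h) - 2 * W x by ring]
  exact h0

/-- Linear interpolation of a function whose derivative is `M`-Lipschitz. -/
lemma abs_sub_linear_interpolation_le {F F' : ℝ → ℝ} {M : ℝ} (hF : ∀ x, HasDerivAt F (F' x) x)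
    (hL : ∀ x y, |F' x - F' y| ≤ M * |x - y|) {h l : ℝ} (hh : 0 ≤ h) (hl0 : 0 ≤ l) (hl1 : l ≤ 1)
    (p : ℝ) : |F (p - l * h) - ((1 - l) * F p + l * F (p - h))| ≤ M * h ^ 2 := by
  have hM0 : 0 ≤ M := by
    have := (abs_nonneg _).trans (hL 1 0)
    simpa using this
  -- Linear functions are interpolated exactly, so `F` may be replaced by `G`, whose derivative is
  -- at most `M h` on the cell.
  set G : ℝ → ℝ := fun y => F y - y * F' p with hG
  have hlip : ∀ y ∈ Icc (p - h) p, ∀ z ∈ Icc (p - h) p, |G z - G y| ≤ M * h * |z - y| := by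
    intro y hy z hz
    refine (convex_Icc (p - h) p).norm_image_sub_le_of_norm_hasDerivWithin_le (f := G)
      (f' := fun y => F' y - F' p) (fun y _ => ?_) (fun y hy => ?_) hy hz
    · exact (((hF y).sub ((hasDerivAt_id y).mul_const (F' p))).congr_deriv
        (by rw [one_mul])).hasDerivWithinAt
    · refine (hL y p).trans (mul_le_mul_of_nonneg_left ?_ hM0)
      exact abs_le.2 ⟨by linarith [hy.1], by linarith [hy.2]⟩
  have hlh : l * h ≤ h := by nlinarith
  have hlh0 : 0 ≤ l * h := by positivity
  have m0 : p ∈ Icc (p - h) p := ⟨by linarith, le_rfl⟩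
  have m1 : p - h ∈ Icc (p - h) p := ⟨le_rfl, by linarith⟩
  have m2 : p - l * h ∈ Icc (p - h) p := ⟨by linarith, by linarith⟩
  have e : F (p - l * h) - ((1 - l) * F p + l * F (p - h))
      = (1 - l) * (G (p - l * h) - G p) + l * (G (p - l * h) - G (p - h)) := by
    simp only [hG]; ring
  have b1 := hlip _ m0 _ m2
  have b2 := hlip _ m1 _ m2
  have a1 : |p - l * h - p| ≤ h := abs_le.2 ⟨by linarith, by linarith⟩
  have a2 : |p - l * h - (p - h)| ≤ h := abs_le.2 ⟨by linarith, by linarith⟩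
  have hMh : 0 ≤ M * h := by positivity
  have c1 := b1.trans (mul_le_mul_of_nonneg_left a1 hMh)
  have c2 := b2.trans (mul_le_mul_of_nonneg_left a2 hMh)
  rw [e]
  refine (abs_add_le _ _).trans ?_
  rw [abs_mul, abs_mul, abs_of_nonneg hl0, abs_of_nonneg (by linarith : 0 ≤ 1 - l)]
  have d1 := mul_le_mul_of_nonneg_left c1 (by linarith : 0 ≤ 1 - l)
  have d2 := mul_le_mul_of_nonneg_left c2 hl0
  linarith

/-! ### Product integration of the kernel against a piecewise linear function -/

lemma intervalIntegrable_kernel {α : ℝ} (hα : α < 2) (a b : ℝ) :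
    IntervalIntegrable (fun y : ℝ => y ^ (1 - α)) volume a b :=
  intervalIntegral.intervalIntegrable_rpow' (by linarith)

/-- The endpoint contributions are separated because they telescope when consecutive cells share
their nodal values. -/
lemma integral_kernel_mul_linear {α h : ℝ} (hα : α ∈ Ioo (1 : ℝ) 2) (hh : 0 < h) (k : ℕ)
    (A B : ℝ) :
    (3 - α) * (2 - α) * ∫ y in ((k : ℝ) * h)..((k + 1 : ℕ) * h),
        y ^ (1 - α) * ((1 - (y / h - k)) * A + (y / h - k) * B)
      = h ^ (2 - α) * ((A - B) * powDiff (3 - α) k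
          + (3 - α) * (((k : ℝ) + 1) ^ (2 - α) * B - (k : ℝ) ^ (2 - α) * A)) := by
  obtain ⟨h1, h2⟩ := hα
  have hk : (0 : ℝ) ≤ k := k.cast_nonneg
  have hc : EqOn (fun y : ℝ => y ^ (1 - α) * ((1 - (y / h - k)) * A + (y / h - k) * B))
      (fun y : ℝ => (A - k * (B - A)) * y ^ (1 - α) + (B - A) / h * y ^ (2 - α))
      (Ioc ((k : ℝ) * h) ((k + 1 : ℕ) * h)) := by
    intro y hy
    have hy0 : 0 < y := lt_of_le_of_lt (by positivity) hy.1
    have : y ^ (2 - α) = y ^ (1 - α) * y := by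
      rw [show 2 - α = (1 - α) + 1 by ring, Real.rpow_add_one hy0.ne']
    simp only [this]
    field_simp
    ring
  have hle : (k : ℝ) * h ≤ (k + 1 : ℕ) * h := by push_cast; nlinarith
  have e2 : (k : ℝ) ^ (3 - α) = (k : ℝ) ^ (2 - α) * k := by
    rw [show 3 - α = (2 - α) + 1 by ring, Real.rpow_add_one' hk (by linarith)]
  have e3 : ((k : ℝ) + 1) ^ (3 - α) = ((k : ℝ) + 1) ^ (2 - α) * (k + 1) := by
    rw [show 3 - α = (2 - α) + 1 by ring, Real.rpow_add_one (by positivity)]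
  have e4 : h ^ (3 - α) = h ^ (2 - α) * h := by
    rw [show 3 - α = (2 - α) + 1 by ring, Real.rpow_add_one hh.ne']
  rw [intervalIntegral.integral_of_le hle, setIntegral_congr_fun measurableSet_Ioc hc,
    ← intervalIntegral.integral_of_le hle, intervalIntegral.integral_add
      ((intervalIntegrable_kernel h2 _ _).const_mul _)
      ((intervalIntegral.intervalIntegrable_rpow' (by linarith)).const_mul _),
    intervalIntegral.integral_const_mul, intervalIntegral.integral_const_mul,
    integral_rpow (Or.inl (by linarith)), integral_rpow (Or.inl (by linarith)),
    show 1 - α + 1 = 2 - α by ring, show 2 - α + 1 = 3 - α by ring]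
  push_cast
  rw [Real.mul_rpow (by positivity) hh.le, Real.mul_rpow hk hh.le,
    Real.mul_rpow (by positivity) hh.le, Real.mul_rpow hk hh.le, e4]
  unfold powDiff
  have n2 : 2 - α ≠ 0 := by linarith
  have n3 : 3 - α ≠ 0 := by linarith
  rw [e2, e3]
  field_simp
  ring

lemma sum_integral_kernel_mul_linear {α h : ℝ} (hα : α ∈ Ioo (1 : ℝ) 2) (hh : 0 < h) (A : ℕ → ℝ)
    (n : ℕ) :
    (3 - α) * (2 - α) * ∑ k ∈ Finset.range n, ∫ y in ((k : ℝ) * h)..((k + 1 : ℕ) * h),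
        y ^ (1 - α) * ((1 - (y / h - k)) * A k + (y / h - k) * A (k + 1))
      = h ^ (2 - α) * (∑ k ∈ Finset.range n, (A k - A (k + 1)) * powDiff (3 - α) k
          + (3 - α) * ((n : ℝ) ^ (2 - α) * A n)) := by
  induction n with
  | zero => simp [Real.zero_rpow (by linarith [hα.2] : 2 - α ≠ 0)]
  | succ n ih =>
    rw [Finset.sum_range_succ, Finset.sum_range_succ, mul_add, ih, integral_kernel_mul_linear hα hh]
    push_cast
    ring

/-- Summation by parts moves the third difference from `b` to `powDiff`, producing the `gCoeff`. The
end terms vanish when `b` samples a function that is zero to the left of the interval. -/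
lemma sum_third_difference_mul_powDiff {α : ℝ} (hα : α ∈ Ioo (1 : ℝ) 2) (b : ℕ → ℝ) (n : ℕ) :
    ∑ k ∈ Finset.range (n + 3), (b k - 3 * b (k + 1) + 3 * b (k + 2) - b (k + 3))
        * powDiff (3 - α) k
      = ∑ j ∈ Finset.range (n + 3), gCoeff α j * b j
        + b (n + 3) * (-3 * powDiff (3 - α) (n + 2) + 3 * powDiff (3 - α) (n + 1)
            - powDiff (3 - α) n)
        + b (n + 4) * (3 * powDiff (3 - α) (n + 2) - powDiff (3 - α) (n + 1))
        - b (n + 5) * powDiff (3 - α) (n + 2) := by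
  induction n with
  | zero =>
    simp only [Finset.sum_range_succ, Finset.sum_range_zero, gCoeff_zero α hα, gCoeff_one α hα,
      gCoeff_two α hα]
    ring
  | succ n ih =>
    rw [show n + 1 + 3 = n + 3 + 1 by ring, Finset.sum_range_succ _ (n + 3), ih,
      Finset.sum_range_succ _ (n + 3), gCoeff_add_three]
    ring_nf

/-! ### Consistency of the space discretization -/

/-- The left half of the discrete Riesz derivative against the left Riemann-Liouville integral
of the second derivative. -/
lemma abs_left_discretization_sub_le {α h M : ℝ} (hα : α ∈ Ioo (1 : ℝ) 2) (hh : 0 < h) {W : ℝ → ℝ}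
    (hW : ContDiff ℝ 4 W) (hM : ∀ x, |iteratedDeriv 4 W x| ≤ M) (hneg : ∀ x ≤ 0, W x = 0) {i : ℕ}
    (hi : 1 ≤ i) :
    |1 / (Real.Gamma (4 - α) * h ^ α)
          * ∑ j ∈ Finset.range (i + 2), gCoeff α j * W ((i : ℝ) * h + h - j * h)
        - 1 / Real.Gamma (2 - α)
          * ∫ y in (0 : ℝ)..(i + 2 : ℕ) * h, y ^ (1 - α) * iteratedDeriv 2 W (i * h - y)|
      ≤ 1 / Real.Gamma (2 - α) * (3 * M * ((i + 2 : ℕ) * h) ^ (2 - α) / (2 - α)) * h ^ 2 := by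
  have h1 := hα.1
  have h2 := hα.2
  have hG2 : 0 < Real.Gamma (2 - α) := Real.Gamma_pos_of_pos (by linarith)
  have hG4 : Real.Gamma (4 - α) = (3 - α) * (2 - α) * Real.Gamma (2 - α) := by
    rw [show 4 - α = (3 - α) + 1 by ring, Real.Gamma_add_one (by linarith),
      show Real.Gamma (3 - α) = Real.Gamma ((2 - α) + 1) by ring_nf,
      Real.Gamma_add_one (by linarith)]
    ring
  have hM0 : 0 ≤ M := (abs_nonneg _).trans (hM 0)
  set b : ℕ → ℝ := fun j => W ((i : ℝ) * h + h - j * h) with hb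
  -- `b (k + 1)` is the value of `W` at `i h - k h`, so `A k` is the central second difference
  -- there.
  set A : ℕ → ℝ := fun k => (b k - 2 * b (k + 1) + b (k + 2)) / h ^ 2 with hA
  set F : ℝ → ℝ := iteratedDeriv 2 W with hF
  have hb0 : ∀ j, i + 1 ≤ j → b j = 0 := by
    intro j hj
    apply hneg
    have : (i : ℝ) + 1 ≤ j := by exact_mod_cast hj
    nlinarith
  have hFd : ∀ x, HasDerivAt F (iteratedDeriv 3 W x) x := fun x => by
    have := ((hW.differentiable_iteratedDeriv 2 (by norm_num)) x).hasDerivAt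
    rwa [← iteratedDeriv_succ] at this
  have hFL : ∀ x y, |iteratedDeriv 3 W x - iteratedDeriv 3 W y| ≤ M * |x - y| := by
    intro x y
    refine convex_univ.norm_image_sub_le_of_norm_hasDerivWithin_le (f := iteratedDeriv 3 W)
      (f' := iteratedDeriv 4 W) (fun z _ => ?_) (fun z _ => hM z) (mem_univ y) (mem_univ x)
    have := ((hW.differentiable_iteratedDeriv 3 (by norm_num)) z).hasDerivAt
    rw [← iteratedDeriv_succ] at this
    exact this.hasDerivWithinAt
  have hFc : Continuous F := continuous_iff_continuousAt.2 fun x => (hFd x).continuousAt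
  have hAF : ∀ k : ℕ, |F (i * h - k * h) - A k| ≤ 2 * M * h ^ 2 := by
    intro k
    have := abs_second_difference_sub_le hW hM hh.le ((i : ℝ) * h - k * h)
    have e : W ((i : ℝ) * h - k * h + h) - 2 * W ((i : ℝ) * h - k * h)
        + W ((i : ℝ) * h - k * h - h) = A k * h ^ 2 := by
      simp only [hA, hb]
      push_cast
      rw [div_mul_cancel₀ _ (by positivity)]
      ring_nf
    rw [e, ← hF, mul_comm (A k), ← mul_sub, abs_mul, abs_of_pos (by positivity), abs_sub_comm]
      at this
    have hh2 : 0 < h ^ 2 := by positivity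
    nlinarith
  have hkint := intervalIntegrable_kernel (α := α) h2
  have hmul : ∀ (a c : ℝ) (g : ℝ → ℝ), Continuous g →
      IntervalIntegrable (fun y => y ^ (1 - α) * g y) volume a c := fun a c g hg =>
    (hkint a c).mul_continuousOn hg.continuousOn
  have hSum := sum_integral_kernel_mul_linear hα hh A (i + 2)
  have hAn : A (i + 2) = 0 := by
    simp only [hA]
    rw [hb0 _ (by omega), hb0 _ (by omega), hb0 _ (by omega)]
    simp
  have hthird : ∑ k ∈ Finset.range (i + 2), (A k - A (k + 1)) * powDiff (3 - α) k
      = (∑ j ∈ Finset.range (i + 2), gCoeff α j * b j) / h ^ 2 := by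
    obtain ⟨m, rfl⟩ := Nat.exists_eq_add_of_le' hi
    have := sum_third_difference_mul_powDiff hα b m
    rw [hb0 (m + 3) (by omega), hb0 (m + 4) (by omega), hb0 (m + 5) (by omega)] at this
    simp only [zero_mul, add_zero, sub_zero] at this
    rw [show m + 1 + 2 = m + 3 by ring, ← this, Finset.sum_div]
    refine Finset.sum_congr rfl fun k _ => ?_
    simp only [hA]
    field_simp
    ring
  rw [hthird, hAn, mul_zero, mul_zero, add_zero] at hSum
  set J : ℕ → ℝ := fun k => ∫ y in ((k : ℝ) * h)..((k + 1 : ℕ) * h),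
    y ^ (1 - α) * ((1 - (y / h - k)) * A k + (y / h - k) * A (k + 1)) with hJ
  have hdisc : 1 / (Real.Gamma (4 - α) * h ^ α) * ∑ j ∈ Finset.range (i + 2), gCoeff α j * b j
      = 1 / Real.Gamma (2 - α) * ∑ k ∈ Finset.range (i + 2), J k := by
    have n2 : 2 - α ≠ 0 := by linarith
    have n3 : 3 - α ≠ 0 := by linarith
    have hpow : h ^ 2 = h ^ (2 - α) * h ^ α := by
      rw [← Real.rpow_add hh, sub_add_cancel]
      norm_num
    have hp1 : h ^ α ≠ 0 := (Real.rpow_pos_of_pos hh _).ne'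
    have hp2 : h ^ (2 - α) ≠ 0 := (Real.rpow_pos_of_pos hh _).ne'
    rw [hpow] at hSum
    have : ∑ k ∈ Finset.range (i + 2), J k
        = (∑ j ∈ Finset.range (i + 2), gCoeff α j * b j) / (h ^ α * ((3 - α) * (2 - α))) := by
      rw [eq_div_iff (by positivity)]
      have e : h ^ (2 - α) * ((∑ j ∈ Finset.range (i + 2), gCoeff α j * b j)
          / (h ^ (2 - α) * h ^ α)) * h ^ α = ∑ j ∈ Finset.range (i + 2), gCoeff α j * b j := by
        field_simp
      rw [← e, ← hSum]
      ring
    rw [this, hG4]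
    field_simp
  have hcont : ∫ y in (0 : ℝ)..(i + 2 : ℕ) * h, y ^ (1 - α) * F (i * h - y)
      = ∑ k ∈ Finset.range (i + 2), ∫ y in ((k : ℝ) * h)..((k + 1 : ℕ) * h),
          y ^ (1 - α) * F (i * h - y) := by
    rw [intervalIntegral.sum_integral_adjacent_intervals (a := fun k : ℕ => (k : ℝ) * h)
      fun k _ => hmul _ _ _ (by fun_prop)]
    simp
  have hle : ∀ k : ℕ, (k : ℝ) * h ≤ (k + 1 : ℕ) * h := fun k => by push_cast; nlinarith
  -- The constant `3M` is `2M` from the second differences at the nodes plus `M` from linear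
  -- interpolation.
  have hterm : ∀ k ∈ Finset.range (i + 2), |J k - ∫ y in ((k : ℝ) * h)..((k + 1 : ℕ) * h),
      y ^ (1 - α) * F (i * h - y)|
      ≤ ∫ y in ((k : ℝ) * h)..((k + 1 : ℕ) * h), 3 * M * h ^ 2 * y ^ (1 - α) := by
    intro k _
    rw [hJ, ← intervalIntegral.integral_sub (hmul _ _ _ (by fun_prop)) (hmul _ _ _ (by fun_prop))]
    rw [← Real.norm_eq_abs]
    refine intervalIntegral.norm_integral_le_of_norm_le (hle k) ?_ ((hkint _ _).const_mul _)
    refine Filter.Eventually.of_forall fun y hy => ?_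
    have hy0 : 0 ≤ y := le_trans (by positivity) hy.1.le
    have hyk : 0 ≤ y ^ (1 - α) := Real.rpow_nonneg hy0 _
    rw [← mul_sub, norm_mul, Real.norm_eq_abs, Real.norm_eq_abs, abs_of_nonneg hyk, mul_comm]
    refine mul_le_mul_of_nonneg_right ?_ hyk
    set l := y / h - k with hl
    have hl0 : 0 ≤ l := by
      rw [hl, sub_nonneg, le_div_iff₀ hh]; exact hy.1.le
    have hl1 : l ≤ 1 := by
      rw [hl, sub_le_iff_le_add, div_le_iff₀ hh]
      have := hy.2
      push_cast at this
      linarith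
    have hint := abs_sub_linear_interpolation_le hFd hFL hh.le hl0 hl1 ((i : ℝ) * h - k * h)
    have e1 : (i : ℝ) * h - k * h - l * h = i * h - y := by
      rw [hl]; field_simp; ring
    have e2 : (i : ℝ) * h - k * h - h = i * h - (k + 1 : ℕ) * h := by push_cast; ring
    rw [e1, e2] at hint
    have d1 := abs_le.1 (hAF k)
    have d2 := abs_le.1 (hAF (k + 1))
    have d3 := abs_le.1 hint
    have hl1' : 0 ≤ 1 - l := by linarith
    rw [abs_le]
    constructor
    · nlinarith [mul_le_mul_of_nonneg_left d1.2 hl1', mul_le_mul_of_nonneg_left d2.2 hl0]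
    · nlinarith [mul_le_mul_of_nonneg_left d1.1 hl1', mul_le_mul_of_nonneg_left d2.1 hl0]
  rw [hdisc, hcont, ← mul_sub, ← Finset.sum_sub_distrib, abs_mul, abs_of_pos (by positivity),
    mul_assoc]
  refine mul_le_mul_of_nonneg_left ?_ (by positivity)
  refine (Finset.abs_sum_le_sum_abs _ _).trans ((Finset.sum_le_sum hterm).trans_eq ?_)
  rw [intervalIntegral.sum_integral_adjacent_intervals (a := fun k : ℕ => (k : ℝ) * h)
      fun k _ => (hkint _ _).const_mul _]
  rw [intervalIntegral.integral_const_mul, integral_rpow (Or.inl (by linarith))]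
  simp only [Nat.cast_zero, zero_mul, show 1 - α + 1 = 2 - α by ring,
    Real.zero_rpow (by linarith : 2 - α ≠ 0), sub_zero]
  ring

/-! ### The Riemann-Liouville derivatives of a smooth function -/

/-- The kernel `y ↦ y_+^{1-α}` of the left fractional integral. -/
def fracKernel (α : ℝ) : ℝ → ℝ := (Ioi 0).indicator fun y => y ^ (1 - α)

open scoped Convolution in
/-- The fractional integral of a function on the whole line. -/
def fracConv (α : ℝ) (g : ℝ → ℝ) : ℝ → ℝ :=
  fracKernel α ⋆[ContinuousLinearMap.mul ℝ ℝ, volume] g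

lemma locallyIntegrable_fracKernel {α : ℝ} (hα : α < 2) : LocallyIntegrable (fracKernel α) := by
  refine LocallyIntegrable.indicator ?_ measurableSet_Ioi
  rw [locallyIntegrable_iff]
  intro k hk
  obtain ⟨a, b, hab⟩ := bddBelow_bddAbove_iff_subset_Icc.1 ⟨hk.bddBelow, hk.bddAbove⟩
  rcases le_or_gt a b with h | h
  · exact ((intervalIntegrable_iff_integrableOn_Icc_of_le h).1
      (intervalIntegrable_kernel hα a b)).mono_set hab
  · rw [Icc_eq_empty h.not_ge] at hab
    exact integrableOn_empty.mono_set hab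

/-- The integrand vanishes for `y > z`, so the upper limit is free; it is later taken as `(i + 2) h`
to match the cells of the stencil. -/
lemma fracConv_eq_integral (α : ℝ) {g : ℝ → ℝ} (hg : ∀ x < 0, g x = 0) {z R : ℝ} (hR : 0 ≤ R)
    (hz : z ≤ R) : fracConv α g z = ∫ y in (0 : ℝ)..R, y ^ (1 - α) * g (z - y) := by
  have h1 : fracConv α g z = ∫ y in Ioi (0 : ℝ), y ^ (1 - α) * g (z - y) := by
    rw [← integral_indicator measurableSet_Ioi]
    unfold fracConv
    rw [convolution_mul]
    refine integral_congr_ae (Filter.Eventually.of_forall fun y => ?_)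
    by_cases hy : y ∈ Ioi (0 : ℝ) <;> simp [fracKernel, hy]
  rw [h1, intervalIntegral.integral_of_le hR]
  refine setIntegral_eq_of_subset_of_forall_sdiff_eq_zero measurableSet_Ioi
    (fun y hy => hy.1) fun y hy => ?_
  have : R < y := by
    by_contra h
    exact hy.2 ⟨hy.1, not_lt.1 h⟩
  rw [hg _ (by linarith), mul_zero]

/-- The kernel is only locally integrable, so both derivatives go onto the compactly supported
smooth factor. -/
lemma iteratedDeriv_two_fracConv {α : ℝ} (hα : α < 2) {W : ℝ → ℝ} (hW : ContDiff ℝ 2 W)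
    (hc : HasCompactSupport W) : iteratedDeriv 2 (fracConv α W) = fracConv α (iteratedDeriv 2 W) := by
  have hk := locallyIntegrable_fracKernel hα
  have hW1 : ContDiff ℝ 1 (deriv W) := by
    have := (contDiff_succ_iff_deriv (n := 1)).1 (hW.of_le (by norm_num))
    exact this.2.2
  have h1 : deriv (fracConv α W) = fracConv α (deriv W) := funext fun x =>
    (hc.hasDerivAt_convolution_right _ hk (hW.of_le (by norm_num)) x).deriv
  have h2 : deriv (fracConv α (deriv W)) = fracConv α (deriv (deriv W)) := funext fun x =>
    (hc.deriv.hasDerivAt_convolution_right _ hk hW1 x).deriv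
  rw [iteratedDeriv_succ, iteratedDeriv_one, h1, h2, iteratedDeriv_succ, iteratedDeriv_one]

lemma leftPotential_eq_fracConv (α : ℝ) {w W : ℝ → ℝ} {xR z : ℝ} (hneg : ∀ x < 0, W x = 0)
    (hwW : ∀ x ∈ Icc 0 xR, w x = W x) (hz : z ∈ Icc 0 xR) :
    leftPotential α w z = fracConv α W z := by
  rw [fracConv_eq_integral α hneg hz.1 le_rfl]
  have h := intervalIntegral.integral_comp_sub_left
    (fun ξ => (z - ξ) ^ (1 - α) * W ξ) z (a := 0) (b := z)
  simp only [sub_sub_cancel, sub_self, sub_zero] at h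
  rw [h]
  unfold leftPotential
  refine intervalIntegral.integral_congr fun ξ hξ => ?_
  rw [uIcc_of_le hz.1] at hξ
  simp only [hwW ξ ⟨hξ.1, hξ.2.trans hz.2⟩]

lemma iteratedDeriv_eq_zero_of_neg {W : ℝ → ℝ} (hneg : ∀ x < 0, W x = 0) (n : ℕ) {x : ℝ}
    (hx : x < 0) : iteratedDeriv n W x = 0 := by
  have : W =ᶠ[nhds x] fun _ => 0 := by
    filter_upwards [Iio_mem_nhds hx] with y hy using hneg y hy
  rw [this.iteratedDeriv_eq]
  simp

/-- The left Riemann-Liouville derivative of a function with a `C²` extension by zero. -/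
lemma leftRL_eq_integral {α : ℝ} (hα : α < 2) {w W : ℝ → ℝ} {xR x R : ℝ} (hW : ContDiff ℝ 2 W)
    (hneg : ∀ x < 0, W x = 0) (hpos : ∀ x > xR, W x = 0) (hwW : ∀ x ∈ Icc 0 xR, w x = W x)
    (hx : x ∈ Ioo 0 xR) (hR : x ≤ R) :
    leftRL α w x
      = 1 / Real.Gamma (2 - α) * ∫ y in (0 : ℝ)..R, y ^ (1 - α) * iteratedDeriv 2 W (x - y) := by
  have hc : HasCompactSupport W := HasCompactSupport.intro (isCompact_Icc (a := 0) (b := xR))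
    fun y hy => by
      rcases lt_or_ge y 0 with h | h
      · exact hneg y h
      · exact hpos y (not_le.1 fun h' => hy ⟨h, h'⟩)
  have heq : leftPotential α w =ᶠ[nhds x] fracConv α W := by
    filter_upwards [Ioo_mem_nhds hx.1 hx.2] with z hz
    exact leftPotential_eq_fracConv α hneg hwW (Ioo_subset_Icc_self hz)
  unfold leftRL
  rw [heq.iteratedDeriv_eq, iteratedDeriv_two_fracConv hα hW hc,
    fracConv_eq_integral α (fun y hy => iteratedDeriv_eq_zero_of_neg hneg 2 hy)
      (hx.1.le.trans hR) hR]

/-- The reflection `y ↦ xR - y` exchanges the two potentials, and a second derivative does not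
change sign under it. -/
lemma rightRL_eq_leftRL (α xR : ℝ) (w : ℝ → ℝ) (x : ℝ) :
    rightRL α xR w x = leftRL α (fun y => w (xR - y)) (xR - x) := by
  have h : rightPotential α xR w = fun z => leftPotential α (fun y => w (xR - y)) (xR - z) := by
    funext z
    unfold rightPotential leftPotential
    have := intervalIntegral.integral_comp_sub_left
      (fun ξ => (ξ - z) ^ (1 - α) * w ξ) xR (a := 0) (b := xR - z)
    rw [sub_zero, sub_sub_cancel] at this
    rw [← this]
    refine intervalIntegral.integral_congr fun y _ => ?_
    simp only [sub_right_comm]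
  unfold rightRL leftRL
  rw [h, iteratedDeriv_comp_const_sub]
  simp

/-! ### The truncation error -/

/-- The discrete Riesz derivative is second order accurate for functions whose extension by zero
is `C⁴` on the line. -/
theorem abs_discrete_riesz_sub_le {α xR M : ℝ} (hα : α ∈ Ioo (1 : ℝ) 2) (hxR : 0 < xR)
    {w W : ℝ → ℝ} (hW : ContDiff ℝ 4 W) (hM : ∀ x, |iteratedDeriv 4 W x| ≤ M)
    (hneg : ∀ x ≤ 0, W x = 0) (hpos : ∀ x ≥ xR, W x = 0) (hwW : ∀ x ∈ Icc 0 xR, w x = W x)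
    {Nx i : ℕ} (hi : i ∈ Finset.Ioo 0 Nx) :
    |rieszCoeff α xR Nx
          * ∑ m ∈ Finset.range (Nx + 1), gEntry α i m * w (m * spaceStep xR Nx)
        - rieszDeriv α xR w (i * spaceStep xR Nx)|
      ≤ kappa α * (2 * (1 / Real.Gamma (2 - α) * (3 * M * (2 * xR) ^ (2 - α) / (2 - α))))
        * spaceStep xR Nx ^ 2 := by
  obtain ⟨hi0, hiN⟩ := Finset.mem_Ioo.1 hi
  have h2 := hα.2
  have hM0 : 0 ≤ M := (abs_nonneg _).trans (hM 0)
  have hG2 : 0 < Real.Gamma (2 - α) := Real.Gamma_pos_of_pos (by linarith)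
  have hh := spaceStep_pos hxR (by omega : 1 ≤ Nx)
  have hNx0 : (0 : ℝ) < Nx := by exact_mod_cast (by omega : 0 < Nx)
  have hstepN : (Nx : ℝ) * spaceStep xR Nx = xR := by
    unfold spaceStep
    field_simp
  set h := spaceStep xR Nx with hdef
  -- One-sided estimate, used for `w` at node `i` and for its reflection at node `Nx - i`. The bound
  -- `(j + 2) h ≤ 2 xR` makes the constant independent of the mesh.
  have hside : ∀ (v V : ℝ → ℝ) (j : ℕ), j ∈ Finset.Ioo 0 Nx → ContDiff ℝ 4 V →
      (∀ x, |iteratedDeriv 4 V x| ≤ M) → (∀ x ≤ 0, V x = 0) → (∀ x ≥ xR, V x = 0) →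
      (∀ x ∈ Icc 0 xR, v x = V x) →
      |1 / (Real.Gamma (4 - α) * h ^ α)
          * ∑ k ∈ Finset.range (j + 2), gCoeff α k * V ((j : ℝ) * h + h - k * h)
        - leftRL α v (j * h)|
      ≤ 1 / Real.Gamma (2 - α) * (3 * M * (2 * xR) ^ (2 - α) / (2 - α)) * h ^ 2 := by
    intro v V j hj hV hVM hVneg hVpos hvV
    obtain ⟨hj0, hjN⟩ := Finset.mem_Ioo.1 hj
    have hj0' : (0 : ℝ) < j := by exact_mod_cast hj0
    have hjN' : (j : ℝ) + 1 ≤ Nx := by exact_mod_cast hjN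
    have hN1 : (1 : ℝ) ≤ Nx := by exact_mod_cast (by omega : 1 ≤ Nx)
    have hjx : (j : ℝ) * h + h ≤ xR := by
      rw [← hstepN]; nlinarith
    have hhx : h ≤ xR := by
      rw [← hstepN]; nlinarith
    have hj2 : ((j + 2 : ℕ) : ℝ) * h ≤ 2 * xR := by push_cast; linarith
    have hj2' : (j : ℝ) * h ≤ (j + 2 : ℕ) * h := by push_cast; linarith
    rw [leftRL_eq_integral h2 (hV.of_le (by norm_num)) (fun x hx => hVneg x hx.le)
      (fun x hx => hVpos x (le_of_lt hx)) hvV ⟨by positivity, by linarith⟩ hj2']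
    refine (abs_left_discretization_sub_le hα hh hV hVM hVneg hj0).trans ?_
    have : 0 < 2 - α := by linarith
    have hpw : (((j + 2 : ℕ) : ℝ) * h) ^ (2 - α) ≤ (2 * xR) ^ (2 - α) :=
      Real.rpow_le_rpow (by positivity) hj2 this.le
    gcongr
  have hL := hside w W i hi hW hM hneg hpos hwW
  have hNi : ((Nx - i : ℕ) : ℝ) * h = xR - i * h := by
    rw [Nat.cast_sub hiN.le, sub_mul, hstepN]
  have hR := hside (fun y => w (xR - y)) (fun y => W (xR - y)) (Nx - i)
    (Finset.mem_Ioo.2 ⟨by omega, by omega⟩) (hW.comp (contDiff_const.sub contDiff_id))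
    (fun x => by
      rw [iteratedDeriv_comp_const_sub]
      simpa using hM (xR - x))
    (fun x hx => hpos _ (by linarith)) (fun x hx => hneg _ (by linarith))
    (fun x hx => hwW _ ⟨by linarith [hx.2], by linarith [hx.1]⟩)
  rw [hNi] at hR
  have hsum : ∑ m ∈ Finset.range (Nx + 1), gEntry α i m * w (m * h)
      = ∑ k ∈ Finset.range (i + 2), gCoeff α k * W ((i : ℝ) * h + h - k * h)
        + ∑ k ∈ Finset.range (Nx - i + 2), gCoeff α k * W (xR - (xR - i * h + h - k * h)) := by
    have e1 : ∑ m ∈ Finset.range (Nx + 1), gEntry α i m * w (m * h)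
        = ∑ m ∈ Finset.range (Nx + 1), gEntry α i m * W (m * h) := by
      refine Finset.sum_congr rfl fun m hm => ?_
      have : (m : ℝ) ≤ Nx := by exact_mod_cast Nat.lt_succ_iff.1 (Finset.mem_range.1 hm)
      rw [hwW _ ⟨by positivity, by rw [← hstepN]; nlinarith⟩]
    rw [e1, sum_gEntry_mul α hi (fun m => W (m * h))]
    congr 1
    · refine Finset.sum_congr rfl fun k hk => ?_
      rw [Nat.cast_sub (by have := Finset.mem_range.1 hk; omega)]
      push_cast
      ring_nf
    · refine Finset.sum_congr rfl fun k hk => ?_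
      rw [Nat.cast_add, Nat.cast_sub (by omega : 1 ≤ i)]
      push_cast
      ring_nf
  have hκ := kappa_pos hα
  have hsplit : ∀ A B a b : ℝ, kappa α / (Real.Gamma (4 - α) * h ^ α) * (A + B) - kappa α * (a + b)
      = kappa α * ((1 / (Real.Gamma (4 - α) * h ^ α) * A - a)
        + (1 / (Real.Gamma (4 - α) * h ^ α) * B - b)) := fun A B a b => by ring
  unfold rieszCoeff rieszDeriv
  rw [← hdef, hsum, rightRL_eq_leftRL, hsplit, abs_mul, abs_of_pos hκ, mul_assoc (kappa α)]
  refine mul_le_mul_of_nonneg_left ?_ hκ.le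
  refine (abs_add_le _ _).trans ((add_le_add hL hR).trans_eq ?_)
  ring

/-- The scheme is consistent of second order in time and space. -/
theorem exists_truncationBound {γ α xR T : ℝ} (hγ : γ ∈ Ioo (0 : ℝ) 1) (hα : α ∈ Ioo (1 : ℝ) 2)
    (hxR : 0 < xR) (hT : 0 < T) {f u : ℝ → ℝ → ℝ}
    (heq : ∀ x ∈ Ioo 0 xR, ∀ t ∈ Ioc 0 T,
      cfDeriv γ (u x) t = rieszDeriv α xR (fun y => u y t) x + f x t)
    (hbdry : ∀ t ∈ Icc 0 T, u 0 t = 0 ∧ u xR t = 0) (hsm : IsSufficientlySmooth xR T u) :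
    ∃ C : ℝ, 0 < C ∧ ∀ (Nx N : ℕ) (τ : ℝ), 1 ≤ Nx → 0 < τ → N * τ ≤ T →
      TruncationBound γ α xR f u Nx N τ C := by
  obtain ⟨M, htime, hspace⟩ := hsm
  have hM0 : 0 ≤ M := (abs_nonneg _).trans ((hspace 0 ⟨le_rfl, hT.le⟩).2 0)
  have hσ := sigma_pos hγ
  have hγ' := sub_pos.2 hγ.2
  have hκ := kappa_pos hα
  have h2 : 0 < 2 - α := sub_pos.2 hα.2
  have hG2 := Real.Gamma_pos_of_pos h2
  set C₁ := 1 / (1 - γ) * (M * sigma γ * T) with hC₁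
  set C₂ := kappa α * (2 * (1 / Real.Gamma (2 - α) * (3 * M * (2 * xR) ^ (2 - α) / (2 - α))))
    with hC₂
  have hC₁0 : 0 ≤ C₁ := by positivity
  have hC₂0 : 0 ≤ C₂ := by positivity
  -- The summand `1` keeps the constant positive when `M = 0`.
  refine ⟨C₁ + C₂ + 1, by positivity, fun Nx N τ hNx hτ hN n hn i hi => ?_⟩
  obtain ⟨hn1, hnN⟩ := Finset.mem_Icc.1 hn
  obtain ⟨hi0, hiN⟩ := Finset.mem_Ioo.1 hi
  have hh := spaceStep_pos hxR hNx
  have hNx0 : (0 : ℝ) < Nx := by exact_mod_cast hNx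
  have hstepN : (Nx : ℝ) * spaceStep xR Nx = xR := by
    unfold spaceStep
    field_simp
  have hx : (i : ℝ) * spaceStep xR Nx ∈ Ioo 0 xR := by
    have h0 : (0 : ℝ) < i := by exact_mod_cast hi0
    have h1 : (i : ℝ) < Nx := by exact_mod_cast hiN
    exact ⟨by positivity, (mul_lt_mul_of_pos_right h1 hh).trans_eq hstepN⟩
  have hnT : (n : ℝ) * τ ≤ T := by
    refine le_trans ?_ hN
    have : (n : ℝ) ≤ N := by exact_mod_cast hnN
    gcongr
  have hn0 : (0 : ℝ) < n := by exact_mod_cast hn1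
  have ht : (n : ℝ) * τ ∈ Ioc 0 T := ⟨by positivity, hnT⟩
  have ht' := Ioc_subset_Icc_self ht
  obtain ⟨hC4, hM4⟩ := hspace _ ht'
  have hb := hbdry _ ht'
  have hS := abs_discrete_riesz_sub_le hα hxR (w := fun y => u y (n * τ)) hC4 hM4
    (fun x hx => by
      rcases hx.eq_or_lt with rfl | hx
      · rw [indicator_of_mem (left_mem_Icc.2 hxR.le), hb.1]
      · exact indicator_of_notMem (fun h => (hx.trans_le h.1).false) _)
    (fun x hx => by
      rcases (show xR ≤ x from hx).eq_or_lt with rfl | hx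
      · rw [indicator_of_mem (right_mem_Icc.2 hxR.le), hb.2]
      · exact indicator_of_notMem (fun h => (hx.trans_le h.2).false) _)
    (fun x hx => (indicator_of_mem hx fun x => u x (n * τ)).symm) hi
  obtain ⟨hC2, hM2⟩ := htime _ hx
  have hTm := abs_time_discretization_sub_cfDeriv_le hγ hT hτ hC2 hM2 hnT
  have he := heq _ hx _ ht
  rw [← hC₁] at hTm
  rw [← hC₂] at hS
  have hτ2 : 0 ≤ τ ^ 2 := sq_nonneg _
  have hh2 : 0 ≤ spaceStep xR Nx ^ 2 := sq_nonneg _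
  unfold truncationError
  have t1 := abs_le.1 hTm
  have t2 := abs_le.1 hS
  -- The differential equation cancels the exact derivatives against `f`, leaving the time error
  -- minus the space error.
  rw [he] at t1
  have p1 := mul_nonneg hC₂0 hτ2
  have p2 := mul_nonneg hC₁0 hh2
  rw [abs_le]
  constructor <;> linarith [t1.1, t1.2, t2.1, t2.2]

end CaputoFabrizio

end

theorem mainTheorem3 (γ α xR T : ℝ) (hγ : γ ∈ Set.Ioo (0 : ℝ) 1) (hα : α ∈ Set.Ioo (1 : ℝ) 2)
    (hxR : 0 < xR) (hT : 0 < T) (f u : ℝ → ℝ → ℝ) (u₀ : ℝ → ℝ)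
    (hu : CaputoFabrizio.IsClassicalSolution γ α xR T f u₀ u) :
    (CaputoFabrizio.IsSufficientlySmooth xR T u →
      ∃ C : ℝ, 0 < C ∧ ∀ (Nx N : ℕ) (τ : ℝ), 1 ≤ Nx → 0 < τ → N * τ ≤ T →
        CaputoFabrizio.TruncationBound γ α xR f u Nx N τ C) ∧
    ∀ (Nx N : ℕ) (τ C : ℝ), 1 ≤ Nx → 0 < τ → N * τ ≤ T → 0 < C →
      CaputoFabrizio.TruncationBound γ α xR f u Nx N τ C →
      ∀ v : ℕ → ℕ → ℝ, CaputoFabrizio.IsSchemeSolution γ α xR f u₀ Nx N τ v →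
      ∀ n ≤ N, ‖CaputoFabrizio.errorVec xR u Nx τ v n‖ ≤
        (1 - γ) * (CaputoFabrizio.sigma γ * T + Real.exp (CaputoFabrizio.sigma γ * τ)) *
          C * (τ ^ 2 + CaputoFabrizio.spaceStep xR Nx ^ 2) :=
  ⟨CaputoFabrizio.exists_truncationBound hγ hα hxR hT hu.equation hu.boundary,
    fun _ _ _ _ hNx hτ hN hC htr _ hv _ hn =>
      CaputoFabrizio.norm_errorVec_le hγ hα hxR hT hu.initial hu.boundary hNx hτ hN hC htr hv hn⟩
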